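/- Let $\mu_0\in(0,1/2]$. There is a constant $C(\mu_0)>0$, depending only on $\mu_0$, such that the following holds. Let $G$ be a finite group with $|G|\ge 2$ and identity $e_G$, let $\alpha\in[0,1)$, and let $\mu$ be a probability measure on $G$ with $\mu(e_G)\ge\mu_0$. Let $S=(S_n)_{n\ge 0}$ be the step-reinforced random walk on $G$ with step distribution $\mu$ and reinforcement parameter $\alpha$ started at $e_G$: $S_0=e_G$ and $S_n=S_{n-1}\cdot X_n$ for $n\ge1$, where $X_1$ has law $\mu$ and, for $n\ge 2$, with probability $\alpha$ one sets $X_n=X_{u_n}$ with $u_n$ uniform on $\{1,\dots,n-1\}$, and with probability $1-\alpha$ one samples $X_n$ from $\mu$, all these choices being independent. Put $$d_\infty(n)=\max_{x\in G}\bigl|\,|G|\,\mathbb P(S_n=x)-1\bigr|,\qquad t_\infty^{(\alpha)}(\varepsilon)=\inf\{n\ge1:\ d_\infty(m)\le\varepsilon\ \text{ for all } m\ge n\}\quad(\inf\emptyset=\infty).$$ For non-empty $A\subset G$ let $\Phi(A)=\frac1{|A|}\sum_{x\in A,\,y\in G\setminus A}\mu(x^{-1}y)$; let $\Phi(r)=\inf\{\Phi(A):\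 \emptyset\ne A\subset G,\ |A|/|G|\le r\}$ for $r\in[1/|G|,1/2]$ and $\Phi(r)=\Phi(1/2)$ for $r>1/2$. Then for every $\varepsilon\in(0,1)$, $$t_\infty^{(\alpha)}(\varepsilon)\ \le\ \frac{C(\mu_0)}{1-\alpha}\int_{4/|G|}^{8/\varepsilon}\frac{du}{u\,\Phi^2(u)},$$ where $1/0=\infty$, so that the right-hand side is $+\infty$ if $\Phi(1/2)=0$. -/

import Mathlib

open MeasureTheory ProbabilityTheory
open scoped ENNReal

/-- `S` is the step-reinforced random walk on `G`, started at the identity, with step distribution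
`μ` and reinforcement parameter `α`, driven by the random variables `ξ n` (`n ≥ 2`), `u n`
(`n ≥ 2`) and `Y n` (`n ≥ 1`), and with step sequence `X n` (`n ≥ 1`).
Here `ξ n` is the Bernoulli variable deciding whether step `n` is a repetition, `u n` is the
uniformly chosen earlier time, and `Y n` is the fresh sample from `μ`.
The values of `ξ, u` at `n = 0, 1` and of `Y, X` at `n = 0` play no role. -/
structure IsSRRWDrivenBy {G : Type*} [Group G] [MeasurableSpace G]
    {Ω : Type*} [MeasurableSpace Ω] (P : Measure Ω) (μ : PMF G) (α : ℝ)
    (ξ : ℕ → Ω → Bool) (u : ℕ → Ω → ℕ) (Y : ℕ → Ω → G) (X : ℕ → Ω → G) (S : ℕ → Ω → G) :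
    Prop where
  measurable_ξ : ∀ n, Measurable (ξ n)
  measurable_u : ∀ n, Measurable (u n)
  measurable_Y : ∀ n, Measurable (Y n)
  /-- The variables belonging to different times are independent. -/
  indep_times : iIndepFun (fun n ω => (ξ n ω, u n ω, Y n ω)) P
  /-- The three variables belonging to the same time are (mutually) independent. -/
  indep_ξ : ∀ n, IndepFun (ξ n) (fun ω => (u n ω, Y n ω)) P
  indep_u : ∀ n, IndepFun (u n) (Y n) P
  /-- `ξ n` is Bernoulli with success parameter `α`. -/
  law_ξ : ∀ n, 2 ≤ n → P {ω | ξ n ω = true} = ENNReal.ofReal α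
  /-- `u n` is uniformly distributed on `{1, …, n - 1}`. -/
  u_mem : ∀ n, 2 ≤ n → ∀ ω, 1 ≤ u n ω ∧ u n ω ≤ n - 1
  law_u : ∀ n, 2 ≤ n → ∀ j, 1 ≤ j → j ≤ n - 1 → P {ω | u n ω = j} = ((n - 1 : ℕ) : ℝ≥0∞)⁻¹
  /-- `Y n` has distribution `μ`. -/
  law_Y : ∀ n, 1 ≤ n → ∀ g, P {ω | Y n ω = g} = μ g
  step_one : ∀ ω, X 1 ω = Y 1 ω
  step : ∀ n, 2 ≤ n → ∀ ω, X n ω = if ξ n ω = true then X (u n ω) ω else Y n ω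
  walk_zero : ∀ ω, S 0 ω = 1
  walk_succ : ∀ n ω, S (n + 1) ω = S n ω * X (n + 1) ω

/-- `S` is a step-reinforced random walk (SRRW) on `G`, started at the identity, with step
distribution `μ` and reinforcement parameter `α`, on the probability space `(Ω, P)`. -/
def IsSRRW {G : Type*} [Group G] [MeasurableSpace G] {Ω : Type*} [MeasurableSpace Ω]
    (P : Measure Ω) (μ : PMF G) (α : ℝ) (S : ℕ → Ω → G) : Prop :=
  ∃ (ξ : ℕ → Ω → Bool) (u : ℕ → Ω → ℕ) (Y : ℕ → Ω → G) (X : ℕ → Ω → G),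
    IsSRRWDrivenBy P μ α ξ u Y X S

/-- The uniform distance `d_∞(n) = max_x | P(S_n = x) |G| - 1 |` (`G` is finite, so the supremum
is a maximum). -/
noncomputable def uniformDist {G : Type*} [Fintype G] {Ω : Type*} [MeasurableSpace Ω]
    (P : Measure Ω) (S : ℕ → Ω → G) (n : ℕ) : ℝ :=
  ⨆ x : G, |P.real {ω | S n ω = x} * (Fintype.card G : ℝ) - 1|

/-- The `ε`-uniform mixing time `inf {n ≥ 1 : d_∞(m) ≤ ε for all m ≥ n}`, which is `⊤` when there
is no such `n`. -/
noncomputable def uniformMixingTime {G : Type*} [Fintype G] {Ω : Type*} [MeasurableSpace Ω]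
    (P : Measure Ω) (S : ℕ → Ω → G) (ε : ℝ) : ℕ∞ :=
  ⨅ (n : ℕ) (_ : 1 ≤ n ∧ ∀ m, n ≤ m → uniformDist P S m ≤ ε), (n : ℕ∞)

/-- The transition matrix `P_μ(x, y) = μ(x⁻¹ y)` of the random walk with step distribution `μ`. -/
def walkKernel {G : Type*} [Group G] (μ : PMF G) (x y : G) : ℝ≥0∞ :=
  μ (x⁻¹ * y)

/-- The bottleneck ratio `Φ(A) = P_μ(A, Aᶜ) / |A|` of a non-empty set `A`, where
`P_μ(A, B) = ∑_{x ∈ A, y ∈ B} P_μ(x, y)`. -/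
noncomputable def bottleneckRatio {G : Type*} [Group G] [Fintype G] [DecidableEq G]
    (μ : PMF G) (A : Finset G) : ℝ≥0∞ :=
  (∑ x ∈ A, ∑ y ∈ Aᶜ, walkKernel μ x y) / (A.card : ℝ≥0∞)

/-- The isoperimetric profile: for `1/|G| ≤ r ≤ 1/2` it is the infimum of `Φ(A)` over the non-empty
`A` with `|A|/|G| ≤ r`, and for `r > 1/2` it is its value at `1/2`. -/
noncomputable def isoperimetricProfile {G : Type*} [Group G] [Fintype G] [DecidableEq G]
    (μ : PMF G) (r : ℝ) : ℝ≥0∞ :=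
  ⨅ (A : Finset G) (_ : A.Nonempty ∧ (A.card : ℝ) / (Fintype.card G : ℝ) ≤ min r (1 / 2)),
    bottleneckRatio μ A

/-! Condition on the repetition pattern `(ξ, u)`. Unrolling the repetitions, each step of the walk
is the fresh sample `Y` at some root time. Call a time in the last half of `{1, …, n}` single if it
is fresh and no time of that half selects it; its sample then occurs exactly once in the product `S
n`, at its own position. With all other samples frozen, `S n` is a word whose letters are constants
of `G` and, at the single times, independent `μ`-distributed elements.

A constant letter is a translation and leaves the `χ²`-distance `v` to uniform unchanged. A random
letter multiplies `v` by at most `1 - (μ₀/8) Φ(4/v)²`, by a Cheeger argument at scale `4/v` and the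
holding probability `μ₀` (`chiSq_conv_pmf_le`). Each random letter thus uses up at least `μ₀/8` of
the integral of `1/(u Φ²)` (`mul_count_le_lintegral`), which bounds the number needed for `v ≤ δ`.
Two consecutive blocks of that length give uniform distance at most `δ`, by Cauchy–Schwarz.

An exponential moment (`lintegral_half_pow_singleTimes_le`) shows that too few single times have
probability exponentially small in `(1 - α) n`. This error enters multiplied by `|G|`, which is
affordable because `Φ ≤ 1` makes the integral at least `log (2|G|/ε)`. -/

/-! ### Cheeger-type inequalities for doubly stochastic kernels. -/

section Kernel

variable {V : Type*} [Fintype V] [DecidableEq V]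

/-- Finite co-area inequality. -/
theorem mul_sum_le_sum_mul_posPart (P : V → V → ℝ) (φ m : ℝ)
    (hφ : ∀ A : Finset V, A.Nonempty → (A.card : ℝ) ≤ m →
      φ * A.card ≤ ∑ x ∈ A, ∑ y ∈ Aᶜ, P x y)
    (F : V → ℝ) (hF : ∀ x, 0 ≤ F x)
    (hm : ((Finset.univ.filter fun x => 0 < F x).card : ℝ) ≤ m) :
    φ * ∑ x, F x ≤ ∑ x, ∑ y, P x y * max (F x - F y) 0 := by
  induction hn : (Finset.univ.filter fun x => 0 < F x).card using Nat.strong_induction_on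
    generalizing F with
  | _ n ih =>
  set A := Finset.univ.filter fun x => 0 < F x with hA
  have memA : ∀ x, x ∈ A ↔ 0 < F x := fun x => by simp [hA]
  have notA : ∀ x, x ∉ A → F x = 0 := fun x hx =>
    le_antisymm (not_lt.mp (mt (memA x).mpr hx)) (hF x)
  rcases A.eq_empty_or_nonempty with h0 | hne
  · have hz : ∀ x, F x = 0 := fun x => notA x (by simp [h0])
    simp [hz]
  obtain ⟨a, haA, hmin⟩ := A.exists_min_image F hne
  -- Peel off the lowest layer: subtracting the least positive value removes at least one point from
  -- the support, and the layer accounts for `F a` times the flow out of `A`.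
  set F' : V → ℝ := fun x => F x - if x ∈ A then F a else 0 with hF'
  have hF'0 : ∀ x, 0 ≤ F' x := by
    intro x
    by_cases hx : x ∈ A
    · simp [hF', hx, hmin x hx]
    · simp [hF', hx, hF x]
  have hsub : (Finset.univ.filter fun x => 0 < F' x) ⊂ A := by
    rw [Finset.ssubset_iff_of_subset]
    · exact ⟨a, haA, by simp [hF', haA]⟩
    · intro x hx
      by_contra hxA
      simp [hF', hxA, notA x hxA] at hx
  have hcard := Finset.card_lt_card hsub
  have hIH := ih _ (hn ▸ hcard) F' hF'0
    (le_trans (by exact_mod_cast hcard.le) hm) rfl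
  have hsumF : ∑ x, F x = ∑ x, F' x + F a * A.card := by
    have : ∑ x, (if x ∈ A then F a else 0) = F a * A.card := by
      rw [Finset.sum_ite_mem]; simp [mul_comm]
    rw [← this, ← Finset.sum_add_distrib]
    exact Finset.sum_congr rfl fun x _ => by simp [hF']
  have hterm : ∀ x y, P x y * max (F x - F y) 0 =
      P x y * max (F' x - F' y) 0 + if x ∈ A then (if y ∈ Aᶜ then P x y * F a else 0) else 0 := by
    intro x y
    by_cases hx : x ∈ A <;> by_cases hy : y ∈ A
    · simp [hF', hx, hy]
    · have h1 : 0 ≤ F x - F a := sub_nonneg.2 (hmin x hx)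
      simp only [hF', hx, hy, notA y hy, if_true, if_false, Finset.mem_compl, not_false_iff]
      rw [max_eq_left (by simpa using hF x), max_eq_left (by simpa using h1)]
      ring
    · have h1 : 0 ≤ F y - F a := sub_nonneg.2 (hmin y hy)
      simp only [hF', hx, hy, notA x hx, if_true, if_false]
      rw [max_eq_right (by simpa using hF y), max_eq_right (by linarith)]
      ring
    · simp [hF', hx, hy]
  have hsum : ∑ x, ∑ y, P x y * max (F x - F y) 0 =
      ∑ x, ∑ y, P x y * max (F' x - F' y) 0 + F a * ∑ x ∈ A, ∑ y ∈ Aᶜ, P x y := by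
    simp_rw [hterm, Finset.sum_add_distrib]
    congr 1
    have : ∀ x, (∑ y, if x ∈ A then (if y ∈ Aᶜ then P x y * F a else 0) else 0) =
        if x ∈ A then ∑ y ∈ Aᶜ, P x y * F a else 0 := by
      intro x
      by_cases hx : x ∈ A
      · simp only [hx, if_true]
        rw [Finset.sum_ite_mem, Finset.univ_inter]
      · simp [hx]
    simp_rw [this]
    rw [Finset.sum_ite_mem, Finset.univ_inter, Finset.mul_sum]
    refine Finset.sum_congr rfl fun x _ => ?_
    rw [Finset.mul_sum]
    exact Finset.sum_congr rfl fun y _ => mul_comm _ _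
  rw [hsumF, hsum, mul_add]
  have h1 := mul_le_mul_of_nonneg_left (hφ A hne hm) (hF a)
  have h2 : φ * (F a * A.card) = F a * (φ * A.card) := by ring
  rw [h2]
  exact add_le_add hIH h1

/-- Cheeger's inequality for functions with small support. -/
theorem sq_mul_sum_sq_le_energy (P : V → V → ℝ) (hP : ∀ x y, 0 ≤ P x y)
    (hrow : ∀ x, ∑ y, P x y = 1) (hcol : ∀ y, ∑ x, P x y = 1) (φ m : ℝ) (hφ0 : 0 ≤ φ)
    (hφ : ∀ A : Finset V, A.Nonempty → (A.card : ℝ) ≤ m →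
      φ * A.card ≤ ∑ x ∈ A, ∑ y ∈ Aᶜ, P x y)
    (g : V → ℝ) (hg : ∀ x, 0 ≤ g x)
    (hm : ((Finset.univ.filter fun x => 0 < g x).card : ℝ) ≤ m) :
    φ ^ 2 / 4 * ∑ x, g x ^ 2 ≤ ∑ x, ∑ y, P x y * (g x - g y) ^ 2 := by
  have h1 := mul_sum_le_sum_mul_posPart P φ m hφ (fun x => g x ^ 2) (fun x => sq_nonneg _)
    (by
      convert hm using 4 with x
      exact ⟨fun h => lt_of_le_of_ne (hg x) (by rintro h'; simp [← h'] at h), fun h => by positivity⟩)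
  -- With `a = |g x - g y|` and `b = g x + g y`, this is `φab ≤ 2a² + φ²b²/8` followed by `b² ≤ 2(g
  -- x² + g y²)`. Summed, the last term is half of `φ² ∑ g²` and can be absorbed.
  have h2 : ∀ x y, φ * (P x y * max (g x ^ 2 - g y ^ 2) 0) ≤
      2 * (P x y * (g x - g y) ^ 2) + φ ^ 2 / 4 * (P x y * g x ^ 2 + P x y * g y ^ 2) := by
    intro x y
    have : φ * max (g x ^ 2 - g y ^ 2) 0 ≤
        2 * (g x - g y) ^ 2 + φ ^ 2 / 4 * (g x ^ 2 + g y ^ 2) := by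
      rcases le_total (g x ^ 2 - g y ^ 2) 0 with h | h
      · rw [max_eq_right h]; simp only [mul_zero]; positivity
      · rw [max_eq_left h]
        nlinarith [sq_nonneg ((g x - g y) - φ / 4 * (g x + g y)),
          mul_nonneg (sq_nonneg φ) (sq_nonneg (g x - g y))]
    nlinarith [mul_le_mul_of_nonneg_left this (hP x y)]
  have hx : ∑ x, ∑ y, P x y * g x ^ 2 = ∑ x, g x ^ 2 := by
    refine Finset.sum_congr rfl fun x _ => ?_
    rw [← Finset.sum_mul, hrow, one_mul]
  have hy : ∑ x, ∑ y, P x y * g y ^ 2 = ∑ x, g x ^ 2 := by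
    rw [Finset.sum_comm]
    refine Finset.sum_congr rfl fun x _ => ?_
    rw [← Finset.sum_mul, hcol, one_mul]
  have h3 : φ * ∑ x, ∑ y, P x y * max (g x ^ 2 - g y ^ 2) 0 ≤
      2 * ∑ x, ∑ y, P x y * (g x - g y) ^ 2 + φ ^ 2 / 4 * (∑ x, g x ^ 2 + ∑ x, g x ^ 2) := by
    nth_rw 1 [← hx]
    rw [← hy]
    simp only [Finset.mul_sum, ← Finset.sum_add_distrib]
    refine Finset.sum_le_sum fun x _ => Finset.sum_le_sum fun y _ => ?_
    exact h2 x y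
  nlinarith [mul_le_mul_of_nonneg_left h1 hφ0]

/-- Take the least value with at most half of the points strictly above it. If more than half lay
below, the next lower value would have more than half above it, and these two disjoint sets would
exceed `V`. -/
theorem exists_median [Nonempty V] (f : V → ℝ) :
    ∃ a : ℝ, 2 * (Finset.univ.filter fun x => a < f x).card ≤ Fintype.card V ∧
      2 * (Finset.univ.filter fun x => f x < a).card ≤ Fintype.card V := by
  set T : Finset V := Finset.univ.filter fun z =>
    2 * (Finset.univ.filter fun x => f z < f x).card ≤ Fintype.card V with hT
  have hTne : T.Nonempty := by
    obtain ⟨z, -, hz⟩ := Finset.exists_max_image Finset.univ f Finset.univ_nonempty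
    refine ⟨z, ?_⟩
    have : (Finset.univ.filter fun x => f z < f x) = ∅ := by
      ext x; simpa using hz x (Finset.mem_univ x)
    simp [hT, this]
  obtain ⟨z, hzT, hz⟩ := T.exists_min_image f hTne
  refine ⟨f z, by simpa [hT] using hzT, ?_⟩
  by_contra! hlt
  have hne : (Finset.univ.filter fun x => f x < f z).Nonempty := by
    rw [← Finset.card_pos]; omega
  obtain ⟨w, hw, hwmax⟩ := Finset.exists_max_image _ f hne
  have hwz : f w < f z := by simpa using hw
  have hwT : w ∉ T := fun h => absurd (hz w h) (not_le.2 hwz)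
  apply hwT
  have hdisj : Disjoint (Finset.univ.filter fun x => f x < f z)
      (Finset.univ.filter fun x => f w < f x) := by
    rw [Finset.disjoint_left]
    intro x hx hx'
    have := hwmax x hx
    simp at hx'
    linarith
  have := Finset.card_le_univ ((Finset.univ.filter fun x => f x < f z) ∪
      (Finset.univ.filter fun x => f w < f x))
  rw [Finset.card_union_of_disjoint hdisj] at this
  simp only [hT, Finset.mem_filter, Finset.mem_univ, true_and]
  omega

/-- A Poincaré inequality for probability densities in terms of the isoperimetric constant at
scale `4 / Var f`. -/
theorem sq_mul_variance_le_energy [Nonempty V] (P : V → V → ℝ) (hP : ∀ x y, 0 ≤ P x y)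
    (hrow : ∀ x, ∑ y, P x y = 1) (hcol : ∀ y, ∑ x, P x y = 1) (φ v : ℝ) (hφ0 : 0 ≤ φ)
    (f : V → ℝ) (hf : ∀ x, 0 ≤ f x) (hf1 : ∑ x, f x = (Fintype.card V : ℝ))
    (hv : v * Fintype.card V = ∑ x, (f x - 1) ^ 2) (hv0 : 0 < v)
    (hφ : ∀ A : Finset V, A.Nonempty → (A.card : ℝ) ≤ min (4 / v) (1 / 2) * Fintype.card V →
      φ * A.card ≤ ∑ x ∈ A, ∑ y ∈ Aᶜ, P x y) :
    φ ^ 2 / 8 * ∑ x, (f x - 1) ^ 2 ≤ ∑ x, ∑ y, P x y * (f x - f y) ^ 2 := by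
  set n : ℝ := (Fintype.card V : ℝ) with hn
  have hφsq := sq_nonneg φ
  rcases le_total (4 / v) (1 / 2) with h | h
  · rw [min_eq_left h] at hφ
    -- Since `f` has mean 1, Markov's inequality bounds the density of the support of this
    -- truncation by `4/v`; at least half of the variance survives it.
    set g : V → ℝ := fun x => max (f x - v / 4) 0 with hg
    have hsupp : ((Finset.univ.filter fun x => 0 < g x).card : ℝ) ≤ 4 / v * n := by
      have h1 : ∑ x ∈ Finset.univ.filter (fun x => 0 < g x), v / 4 ≤ ∑ x, f x := by
        refine le_trans (Finset.sum_le_sum (f := fun _ => v / 4) (g := f) ?_)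
          (Finset.sum_le_sum_of_subset_of_nonneg (Finset.subset_univ _) fun x _ _ => hf x)
        intro x hx
        simp [hg] at hx
        linarith
      rw [Finset.sum_const, nsmul_eq_mul, hf1] at h1
      rw [div_mul_eq_mul_div, le_div_iff₀ hv0]
      linarith
    have hC := sq_mul_sum_sq_le_energy P hP hrow hcol φ _ hφ0 hφ g
      (fun x => le_max_right _ _) hsupp
    have hle : ∑ x, ∑ y, P x y * (g x - g y) ^ 2 ≤ ∑ x, ∑ y, P x y * (f x - f y) ^ 2 := by
      refine Finset.sum_le_sum fun x _ => Finset.sum_le_sum fun y _ =>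
        mul_le_mul_of_nonneg_left ?_ (hP x y)
      apply sq_le_sq.2
      have := abs_max_sub_max_le_abs (f x - v / 4) (f y - v / 4) 0
      simpa [hg] using this
    have hpt : ∀ x, (f x - 1) ^ 2 + 2 * (1 - v / 4) * f x - 1 ≤ g x ^ 2 := by
      intro x
      simp only [hg]
      rcases le_total (f x - v / 4) 0 with h' | h'
      · rw [max_eq_right h']; nlinarith [hf x]
      · rw [max_eq_left h']; nlinarith [hf x]
    have hsum : ∑ x, (f x - 1) ^ 2 / 2 ≤ ∑ x, g x ^ 2 := by
      have := Finset.sum_le_sum fun x (_ : x ∈ Finset.univ) => hpt x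
      rw [Finset.sum_sub_distrib, Finset.sum_add_distrib, ← Finset.mul_sum, hf1] at this
      simp only [Finset.sum_const, Finset.card_univ, nsmul_eq_mul, mul_one] at this
      rw [← Finset.sum_div]
      have hn0 : 0 ≤ n := by positivity
      nlinarith
    rw [← Finset.sum_div] at hsum
    nlinarith [mul_le_mul_of_nonneg_left hsum hφsq]
  · rw [min_eq_right h] at hφ
    obtain ⟨a, ha1, ha2⟩ := exists_median f
    have ha1' : (2 : ℝ) * (Finset.univ.filter fun x => a < f x).card ≤ n := by
      rw [hn]; exact_mod_cast ha1
    have ha2' : (2 : ℝ) * (Finset.univ.filter fun x => f x < a).card ≤ n := by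
      rw [hn]; exact_mod_cast ha2
    have hC1 := sq_mul_sum_sq_le_energy P hP hrow hcol φ _ hφ0 hφ (fun x => max (f x - a) 0)
      (fun x => le_max_right _ _) (by
        have : (Finset.univ.filter fun x => 0 < max (f x - a) 0) =
          (Finset.univ.filter fun x => a < f x) := by ext x; simp
        rw [this]; linarith)
    have hC2 := sq_mul_sum_sq_le_energy P hP hrow hcol φ _ hφ0 hφ (fun x => max (a - f x) 0)
      (fun x => le_max_right _ _) (by
        have : (Finset.univ.filter fun x => 0 < max (a - f x) 0) =
          (Finset.univ.filter fun x => f x < a) := by ext x; simp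
        rw [this]; linarith)
    -- Expansion of `(f x - a)²` around 1 without the term `(1 - a)²`; the linear term sums to zero.
    have hsq : ∀ x, (f x - 1) ^ 2 + 2 * (1 - a) * (f x - 1) ≤
        max (f x - a) 0 ^ 2 + max (a - f x) 0 ^ 2 := by
      intro x
      rcases le_total (f x) a with h' | h'
      · rw [max_eq_right (by linarith : f x - a ≤ 0), max_eq_left (by linarith : 0 ≤ a - f x)]
        nlinarith [sq_nonneg (1 - a)]
      · rw [max_eq_left (by linarith : 0 ≤ f x - a), max_eq_right (by linarith : a - f x ≤ 0)]
        nlinarith [sq_nonneg (1 - a)]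
    have hsum := Finset.sum_le_sum fun x (_ : x ∈ Finset.univ) => hsq x
    have h0 : ∑ x, (f x - 1) = 0 := by simp [Finset.sum_sub_distrib, hf1, hn]
    rw [Finset.sum_add_distrib, Finset.sum_add_distrib, ← Finset.mul_sum, h0] at hsum
    have hE : ∑ x, ∑ y, P x y * (max (f x - a) 0 - max (f y - a) 0) ^ 2 +
        ∑ x, ∑ y, P x y * (max (a - f x) 0 - max (a - f y) 0) ^ 2 ≤
        ∑ x, ∑ y, P x y * (f x - f y) ^ 2 := by
      simp only [← Finset.sum_add_distrib, ← mul_add]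
      refine Finset.sum_le_sum fun x _ => Finset.sum_le_sum fun y _ =>
        mul_le_mul_of_nonneg_left ?_ (hP x y)
      have key : ∀ s t : ℝ, (max s 0 - max t 0) ^ 2 + (max (-s) 0 - max (-t) 0) ^ 2
          ≤ (s - t) ^ 2 := by
        intro s t
        have hs : max s 0 - max (-s) 0 = s := by simp
        have ht : max t 0 - max (-t) 0 = t := by simp
        have hs' : max s 0 * max (-s) 0 = 0 := by
          rcases le_total s 0 with h | h <;> simp [h]
        have ht' : max t 0 * max (-t) 0 = 0 := by
          rcases le_total t 0 with h | h <;> simp [h]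
        have h1 : 0 ≤ max s 0 * max (-t) 0 := by positivity
        have h2 : 0 ≤ max t 0 * max (-s) 0 := by positivity
        have h3 : (s - t) ^ 2 = (max s 0 - max (-s) 0 - (max t 0 - max (-t) 0)) ^ 2 := by
          rw [hs, ht]
        rw [h3]
        linarith
      have := key (f x - a) (f y - a)
      simpa using this
    have hpos : 0 ≤ ∑ x, (f x - 1) ^ 2 := Finset.sum_nonneg fun x _ => sq_nonneg _
    nlinarith [mul_le_mul_of_nonneg_left hsum hφsq, mul_nonneg hφsq hpos]

/-- One step of a doubly stochastic kernel with holding probability at least `θ` decreases the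
`ℓ²` norm by at least `θ` times the energy. -/
theorem sum_sq_step_le (P : V → V → ℝ) (hP : ∀ x y, 0 ≤ P x y)
    (hrow : ∀ x, ∑ y, P x y = 1) (hcol : ∀ y, ∑ x, P x y = 1) (θ : ℝ)
    (hθ : ∀ x, θ ≤ P x x) (f : V → ℝ) :
    ∑ y, (∑ x, f x * P x y) ^ 2 ≤
      ∑ x, f x ^ 2 - θ * ∑ x, ∑ y, P x y * (f x - f y) ^ 2 := by
  have key : ∀ y, (∑ x, f x * P x y) ^ 2 ≤
      ∑ x, P x y * f x ^ 2 - θ * ∑ x, P x y * (f x - f y) ^ 2 := by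
    intro y
    set D := ∑ x, P x y * (f x - f y) ^ 2 with hD
    set M := ∑ x, P x y * (f x - f y) with hM
    have hDpos : 0 ≤ D := Finset.sum_nonneg fun x _ => mul_nonneg (hP x y) (sq_nonneg _)
    have h1 : ∑ x, f x * P x y = M + f y := by
      rw [hM]
      simp only [mul_sub, Finset.sum_sub_distrib, ← Finset.sum_mul, hcol]
      rw [one_mul, sub_add_cancel]
      exact Finset.sum_congr rfl fun x _ => mul_comm _ _
    have h2 : D = ∑ x, P x y * f x ^ 2 - 2 * f y * (M + f y) + f y ^ 2 := by
      have h4 : f y ^ 2 = ∑ x, P x y * f y ^ 2 := by rw [← Finset.sum_mul, hcol, one_mul]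
      rw [← h1, hD, Finset.mul_sum, ← Finset.sum_sub_distrib, h4, ← Finset.sum_add_distrib]
      exact Finset.sum_congr rfl fun x _ => by ring
    -- The diagonal term of `M` vanishes, so Cauchy–Schwarz runs over mass `1 - P y y` only. This is
    -- how the holding probability enters, and no reversibility is needed.
    have h3 : M ^ 2 ≤ (1 - P y y) * D := by
      have hMe : M = ∑ x ∈ Finset.univ.erase y, P x y * (f x - f y) := by
        rw [hM, ← Finset.add_sum_erase _ _ (Finset.mem_univ y)]; simp
      have hDe : D = ∑ x ∈ Finset.univ.erase y, P x y * (f x - f y) ^ 2 := by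
        rw [hD, ← Finset.add_sum_erase _ _ (Finset.mem_univ y)]; simp
      have hPe : 1 - P y y = ∑ x ∈ Finset.univ.erase y, P x y := by
        rw [← hcol y, ← Finset.add_sum_erase _ _ (Finset.mem_univ y)]; ring
      rw [hMe, hDe, hPe]
      exact Finset.sum_sq_le_sum_mul_sum_of_sq_le_mul _ (fun x _ => hP x y)
        (fun x _ => mul_nonneg (hP x y) (sq_nonneg _)) (fun x _ => le_of_eq (by ring))
    rw [h1]
    nlinarith [mul_le_mul_of_nonneg_right (hθ y) hDpos]
  refine (Finset.sum_le_sum fun y _ => key y).trans (le_of_eq ?_)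
  rw [Finset.sum_sub_distrib, ← Finset.mul_sum, Finset.sum_comm]
  congr 1
  · refine Finset.sum_congr rfl fun x _ => ?_
    rw [← Finset.sum_mul, hrow, one_mul]
  · rw [Finset.sum_comm]

end Kernel

/-! ### Convolution, `χ²`-distance and words with random and constant letters. -/

section Word

variable {G : Type*} [Fintype G]

/-- The `χ²`-distance to the uniform distribution. -/
def chiSq (p : G → ℝ) : ℝ := Fintype.card G * ∑ x, p x ^ 2 - 1

theorem sum_sq_sub_one (p : G → ℝ) (hp : ∑ x, p x = 1) :
    ∑ x, (Fintype.card G * p x - 1) ^ 2 = chiSq p * Fintype.card G := by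
  have : ∀ x, (Fintype.card G * p x - 1) ^ 2 =
      (Fintype.card G : ℝ) ^ 2 * p x ^ 2 - 2 * Fintype.card G * p x + 1 := fun x => by ring
  simp only [this, Finset.sum_add_distrib, Finset.sum_sub_distrib, ← Finset.mul_sum, hp]
  simp [chiSq]
  ring

theorem sum_toReal_pmf (μ : PMF G) : ∑ x, (μ x).toReal = 1 := by
  rw [← ENNReal.toReal_sum fun x _ => μ.apply_ne_top x, ← tsum_fintype (L := .unconditional G),
    μ.tsum_coe, ENNReal.toReal_one]

variable [Group G]

/-- Convolution of functions on a finite group. -/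
def conv (p q : G → ℝ) (x : G) : ℝ := ∑ z, p z * q (z⁻¹ * x)

theorem sum_conv (p q : G → ℝ) : ∑ x, conv p q x = (∑ x, p x) * ∑ x, q x := by
  simp only [conv]
  rw [Finset.sum_comm, Finset.sum_mul]
  refine Finset.sum_congr rfl fun z _ => ?_
  rw [← Finset.mul_sum]
  congr 1
  exact Fintype.sum_equiv (Equiv.mulLeft z⁻¹) _ _ fun x => rfl

theorem conv_assoc (p q r : G → ℝ) : conv (conv p q) r = conv p (conv q r) := by
  funext x
  simp only [conv, Finset.sum_mul, Finset.mul_sum]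
  rw [Finset.sum_comm]
  refine Finset.sum_congr rfl fun z _ => ?_
  refine Fintype.sum_equiv (Equiv.mulLeft z⁻¹) _ _ fun y => ?_
  simp [mul_assoc]

theorem conv_nonneg {p q : G → ℝ} (hp : ∀ x, 0 ≤ p x) (hq : ∀ x, 0 ≤ q x) (x : G) :
    0 ≤ conv p q x := Finset.sum_nonneg fun z _ => mul_nonneg (hp z) (hq _)

/-- The uniform distance after a product of two laws is controlled by their `χ²`-distances. -/
theorem abs_card_mul_conv_sub_one_le (p q : G → ℝ) (hp : ∑ x, p x = 1) (hq : ∑ x, q x = 1)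
    {δ : ℝ} (hδ : 0 ≤ δ) (hpδ : chiSq p ≤ δ) (hqδ : chiSq q ≤ δ) (x : G) :
    |conv p q x * Fintype.card G - 1| ≤ δ := by
  set n : ℝ := (Fintype.card G : ℝ) with hn
  have hn0 : 0 < n := by rw [hn]; exact_mod_cast Fintype.card_pos
  have hqx : ∑ z, q (z⁻¹ * x) = 1 := by
    rw [← hq]
    exact Fintype.sum_equiv ((Equiv.inv G).trans (Equiv.mulRight x)) _ _ fun z => rfl
  have hqx2 : ∑ z, (n * q (z⁻¹ * x) - 1) ^ 2 = ∑ z, (n * q z - 1) ^ 2 :=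
    Fintype.sum_equiv ((Equiv.inv G).trans (Equiv.mulRight x)) _ _ fun z => rfl
  -- After centring, the convolution is an inner product of `n p - 1` with a reflected translate of
  -- `n q - 1`, whose norm is that of `n q - 1`; Cauchy–Schwarz finishes.
  have h1 : n * (conv p q x * n - 1) = ∑ z, (n * p z - 1) * (n * q (z⁻¹ * x) - 1) := by
    have : ∀ z, (n * p z - 1) * (n * q (z⁻¹ * x) - 1) =
        n ^ 2 * (p z * q (z⁻¹ * x)) - n * p z - n * q (z⁻¹ * x) + 1 := fun z => by ring
    simp only [this, Finset.sum_add_distrib, Finset.sum_sub_distrib, ← Finset.mul_sum, hp, hqx]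
    simp [conv, ← hn]
    ring
  have h2 : (n * (conv p q x * n - 1)) ^ 2 ≤ (δ * n) ^ 2 := by
    rw [h1]
    refine (Finset.sum_mul_sq_le_sq_mul_sq _ _ _).trans ?_
    rw [hqx2, sum_sq_sub_one p hp, sum_sq_sub_one q hq, sq (δ * n)]
    have hq0 : 0 ≤ chiSq q * n := by
      rw [hn, ← sum_sq_sub_one q hq]; exact Finset.sum_nonneg fun _ _ => sq_nonneg _
    exact mul_le_mul (mul_le_mul_of_nonneg_right hpδ hn0.le)
      (mul_le_mul_of_nonneg_right hqδ hn0.le) hq0 (by positivity)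
  have h3 := abs_le_of_sq_le_sq h2 (by positivity)
  rw [abs_mul, abs_of_pos hn0, mul_comm δ] at h3
  exact le_of_mul_le_mul_left h3 hn0

variable [DecidableEq G]

theorem conv_single (p : G → ℝ) (c x : G) : conv p (Pi.single c 1) x = p (x * c⁻¹) := by
  simp only [conv]
  rw [Finset.sum_eq_single (x * c⁻¹)]
  · simp
  · intro z _ hz
    rw [Pi.single_eq_of_ne, mul_zero]
    rintro h
    exact hz (by rw [← h]; group)
  · simp

/-- The law of a product of independent factors, where a letter `none` stands for a
`μ`-distributed factor and `some c` for the constant factor `c`.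
The head of the list is the rightmost factor. -/
def wordLaw (q : G → ℝ) : List (Option G) → G → ℝ
  | [] => Pi.single 1 1
  | none :: w => conv (wordLaw q w) q
  | some c :: w => conv (wordLaw q w) (Pi.single c 1)

theorem wordLaw_append (q : G → ℝ) (w₁ w₂ : List (Option G)) :
    wordLaw q (w₁ ++ w₂) = conv (wordLaw q w₂) (wordLaw q w₁) := by
  induction w₁ with
  | nil => funext x; simp [wordLaw, conv_single]
  | cons a w ih => cases a <;> simp [wordLaw, ih, conv_assoc]

theorem wordLaw_nonneg {q : G → ℝ} (hq : ∀ x, 0 ≤ q x) (w : List (Option G)) (x : G) :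
    0 ≤ wordLaw q w x := by
  have h1 : ∀ c x : G, 0 ≤ (Pi.single c 1 : G → ℝ) x := fun c x => by
    by_cases h : x = c <;> simp [h]
  induction w generalizing x with
  | nil => exact h1 1 x
  | cons a w ih =>
    cases a
    · exact conv_nonneg ih hq x
    · exact conv_nonneg ih (h1 _) x

theorem sum_wordLaw {q : G → ℝ} (hq : ∑ x, q x = 1) (w : List (Option G)) :
    ∑ x, wordLaw q w x = 1 := by
  induction w with
  | nil => simp [wordLaw]
  | cons a w ih => cases a <;> simp [wordLaw, sum_conv, ih, hq]

/-- A translation only permutes the values, so frozen steps of the walk cost nothing. -/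
theorem chiSq_conv_single (p : G → ℝ) (c : G) : chiSq (conv p (Pi.single c 1)) = chiSq p := by
  simp only [chiSq, conv_single]
  congr 2
  exact Fintype.sum_equiv (Equiv.mulRight c⁻¹) _ _ fun x => rfl

/-! ### The isoperimetric profile and the decay of `χ²` along a word. -/

theorem isoperimetricProfile_anti (μ : PMF G) : Antitone (isoperimetricProfile μ) := by
  intro r s hrs
  refine le_iInf₂ fun A hA => iInf₂_le A ⟨hA.1, hA.2.trans (min_le_min_right _ hrs)⟩

theorem isoperimetricProfile_le_one [Nontrivial G] (μ : PMF G) {r : ℝ}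
    (hr : 1 / (Fintype.card G : ℝ) ≤ r) : isoperimetricProfile μ r ≤ 1 := by
  have hc : (2 : ℝ) ≤ Fintype.card G := by exact_mod_cast Fintype.one_lt_card (α := G)
  have h1 : (({1} : Finset G).card : ℝ) / Fintype.card G ≤ min r (1 / 2) := by
    rw [Finset.card_singleton, Nat.cast_one]
    exact le_min hr (one_div_le_one_div_of_le two_pos hc)
  refine (iInf₂_le ({1} : Finset G) ⟨by simp, h1⟩).trans ?_
  simp only [bottleneckRatio, Finset.sum_singleton, Finset.card_singleton, Nat.cast_one,
    div_one, walkKernel, inv_one, one_mul]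
  refine (Finset.sum_le_sum_of_subset (Finset.subset_univ _)).trans ?_
  rw [← tsum_fintype (L := .unconditional G), μ.tsum_coe]

theorem isoperimetricProfile_half_le (μ : PMF G) (r : ℝ) :
    isoperimetricProfile μ (1 / 2) ≤ isoperimetricProfile μ r :=
  le_iInf₂ fun A hA => iInf₂_le A ⟨hA.1, hA.2.trans (by simp)⟩

theorem toReal_isoperimetricProfile_mul_card_le (μ : PMF G) {r : ℝ} {A : Finset G}
    (hA : A.Nonempty) (hr : (A.card : ℝ) ≤ min r (1 / 2) * Fintype.card G) :
    (isoperimetricProfile μ r).toReal * A.card ≤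
      ∑ x ∈ A, ∑ y ∈ Aᶜ, (μ (x⁻¹ * y)).toReal := by
  have hn : (0 : ℝ) < Fintype.card G := by exact_mod_cast Fintype.card_pos
  have h1 : isoperimetricProfile μ r ≤ bottleneckRatio μ A :=
    iInf₂_le A ⟨hA, by rwa [div_le_iff₀ hn]⟩
  have hne : ∑ x ∈ A, ∑ y ∈ Aᶜ, walkKernel μ x y ≠ ⊤ := by
    simp [walkKernel, ENNReal.sum_eq_top, μ.apply_ne_top]
  have h2 := (ENNReal.mul_le_of_le_div h1)
  have h3 := ENNReal.toReal_mono hne h2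
  rw [ENNReal.toReal_mul, ENNReal.toReal_natCast, ENNReal.toReal_sum
    (fun x _ => by simp [walkKernel, ENNReal.sum_eq_top, μ.apply_ne_top])] at h3
  refine h3.trans (le_of_eq (Finset.sum_congr rfl fun x _ => ?_))
  exact ENNReal.toReal_sum fun y _ => μ.apply_ne_top _

/-- The density `|G| p` has variance `chiSq p`, so the Poincaré inequality at its own scale bounds
the energy from below, and `sum_sq_step_le` with `θ = μ₀` turns energy into decay. -/
theorem chiSq_conv_pmf_le (μ : PMF G) {μ₀ : ℝ} (hμ₀ : 0 ≤ μ₀) (hμ : ENNReal.ofReal μ₀ ≤ μ 1)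
    (p : G → ℝ) (hp0 : ∀ x, 0 ≤ p x) (hp : ∑ x, p x = 1) (hpos : 0 < chiSq p) :
    chiSq (conv p fun x => (μ x).toReal) ≤
      chiSq p * (1 - μ₀ / 8 * (isoperimetricProfile μ (4 / chiSq p)).toReal ^ 2) := by
  set n : ℝ := (Fintype.card G : ℝ) with hn
  have hn0 : 0 < n := by rw [hn]; exact_mod_cast Fintype.card_pos
  set φ := (isoperimetricProfile μ (4 / chiSq p)).toReal with hφ
  have hP : ∀ x y : G, 0 ≤ (μ (x⁻¹ * y)).toReal := fun _ _ => ENNReal.toReal_nonneg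
  have hrow : ∀ x : G, ∑ y, (μ (x⁻¹ * y)).toReal = 1 := fun x => by
    rw [← sum_toReal_pmf μ]
    exact Fintype.sum_equiv (Equiv.mulLeft x⁻¹) _ _ fun _ => rfl
  have hcol : ∀ y : G, ∑ x, (μ (x⁻¹ * y)).toReal = 1 := fun y => by
    rw [← sum_toReal_pmf μ]
    exact Fintype.sum_equiv ((Equiv.inv G).trans (Equiv.mulRight y)) _ _ fun _ => rfl
  have hE := sq_mul_variance_le_energy (fun x y : G => (μ (x⁻¹ * y)).toReal) hP hrow hcol φ
    (chiSq p) ENNReal.toReal_nonneg (fun x => n * p x) (fun x => mul_nonneg hn0.le (hp0 x))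
    (by rw [← Finset.mul_sum, hp, mul_one]) (sum_sq_sub_one p hp).symm hpos
    (fun A hA hc => toReal_isoperimetricProfile_mul_card_le μ hA hc)
  have hstep := sum_sq_step_le (fun x y : G => (μ (x⁻¹ * y)).toReal) hP hrow hcol μ₀
    (fun x => by
      rw [inv_mul_cancel]
      exact (ENNReal.ofReal_le_iff_le_toReal (μ.apply_ne_top 1)).1 hμ) p
  have hscale : ∑ x, ∑ y, (μ (x⁻¹ * y)).toReal * (n * p x - n * p y) ^ 2 =
      n ^ 2 * ∑ x, ∑ y, (μ (x⁻¹ * y)).toReal * (p x - p y) ^ 2 := by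
    simp only [Finset.mul_sum]
    exact Finset.sum_congr rfl fun x _ => Finset.sum_congr rfl fun y _ => by ring
  rw [hscale, sum_sq_sub_one p hp, ← hn] at hE
  set E := ∑ x, ∑ y, (μ (x⁻¹ * y)).toReal * (p x - p y) ^ 2 with hEdef
  have hE' : φ ^ 2 / 8 * chiSq p ≤ n * E := by
    refine le_of_mul_le_mul_right (a := n) ?_ hn0
    linarith
  have h1 : chiSq (conv p fun x => (μ x).toReal) ≤ chiSq p - μ₀ * (n * E) := by
    have := mul_le_mul_of_nonneg_left hstep hn0.le
    simp only [chiSq, conv, ← hn]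
    linarith
  nlinarith [mul_le_mul_of_nonneg_left hE' hμ₀]

/-- The integral over `[4 / v, 4 / v')` of the mixing-time integrand dominates a constant if
the variance drops from `v` to `v'` in one step. -/
theorem ofReal_le_lintegral_Ico [Nontrivial G] (μ : PMF G) {c v v' : ℝ} (hv' : 0 < v')
    (hv : v < Fintype.card G)
    (hstep : v' ≤ v * (1 - c * (isoperimetricProfile μ (4 / v)).toReal ^ 2)) (hvv : v' ≤ v)
    (hΦ : isoperimetricProfile μ (1 / 2) ≠ 0) :
    ENNReal.ofReal c ≤ ∫⁻ u in Set.Ico (4 / v) (4 / v'),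
      1 / (ENNReal.ofReal u * isoperimetricProfile μ u ^ 2) := by
  have hv0 : 0 < v := hv'.trans_le hvv
  have hb : 0 < 4 / v' := by positivity
  have hn : (0 : ℝ) < Fintype.card G := hv0.trans hv
  have htop : isoperimetricProfile μ (4 / v) ≠ ⊤ := by
    refine ne_top_of_le_ne_top ENNReal.one_ne_top (isoperimetricProfile_le_one μ ?_)
    rw [div_le_div_iff₀ hn hv0]
    linarith
  set φ := (isoperimetricProfile μ (4 / v)).toReal with hφ
  have hφ0 : 0 < φ := ENNReal.toReal_pos
    (fun h => hΦ (le_antisymm (h ▸ isoperimetricProfile_half_le μ _) bot_le)) htop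
  have hφeq : isoperimetricProfile μ (4 / v) = ENNReal.ofReal φ := (ENNReal.ofReal_toReal htop).symm
  -- On this interval `u < 4 / v'`, and `Φ(u) ≤ φ` by monotonicity. Multiplying the resulting
  -- constant by the length gives `(1 - v'/v) / φ²`, which is at least `c` by `hstep`.
  have h1 : ∫⁻ _ in Set.Ico (4 / v) (4 / v'), ENNReal.ofReal (1 / (4 / v' * φ ^ 2)) ≤
      ∫⁻ u in Set.Ico (4 / v) (4 / v'),
        1 / (ENNReal.ofReal u * isoperimetricProfile μ u ^ 2) := by
    refine setLIntegral_mono_ae' measurableSet_Ico (ae_of_all _ fun u hu => ?_)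
    rw [ENNReal.ofReal_div_of_pos (by positivity), ENNReal.ofReal_one]
    refine ENNReal.div_le_div_left ?_ 1
    rw [ENNReal.ofReal_mul hb.le, ENNReal.ofReal_pow hφ0.le, ← hφeq]
    gcongr
    · exact hu.2.le
    · exact isoperimetricProfile_anti μ hu.1
  refine le_trans ?_ h1
  rw [setLIntegral_const, Real.volume_Ico, ← ENNReal.ofReal_mul (by positivity)]
  refine ENNReal.ofReal_le_ofReal ?_
  have h2 : 1 / (4 / v' * φ ^ 2) * (4 / v' - 4 / v) = (1 - v' / v) / φ ^ 2 := by
    field_simp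
  rw [h2, le_div_iff₀ (by positivity), le_sub_comm, div_le_iff₀ hv0, mul_comm]
  exact hstep

/-- As long as the `χ²`-distance of the law of a word is positive, the number of `μ`-distributed
letters is controlled by the isoperimetric integral. -/
theorem mul_count_le_lintegral [Nontrivial G] (μ : PMF G) {μ₀ : ℝ} (hμ₀ : 0 ≤ μ₀)
    (hμ : ENNReal.ofReal μ₀ ≤ μ 1) (hΦ : isoperimetricProfile μ (1 / 2) ≠ 0)
    (w : List (Option G)) :
    chiSq (wordLaw (fun x => (μ x).toReal) w) < Fintype.card G ∧
    (0 < chiSq (wordLaw (fun x => (μ x).toReal) w) →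
      ENNReal.ofReal (μ₀ / 8) * (w.count none : ℕ) ≤
        ∫⁻ u in Set.Ico (4 / (Fintype.card G : ℝ))
            (4 / chiSq (wordLaw (fun x => (μ x).toReal) w)),
          1 / (ENNReal.ofReal u * isoperimetricProfile μ u ^ 2)) := by
  have hn : (0 : ℝ) < Fintype.card G := by exact_mod_cast Fintype.card_pos
  induction w with
  | nil =>
    -- The point mass has `χ²` equal to `|G| - 1`, which is why the integral starts at `4/|G|`.
    refine ⟨?_, fun _ => by simp⟩
    have : ∑ x : G, (Pi.single 1 1 : G → ℝ) x ^ 2 = 1 := by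
      rw [Finset.sum_eq_single 1] <;> simp +contextual
    simp [chiSq, wordLaw, this]
  | cons a w ih =>
    cases a with
    | some c => simpa [wordLaw, chiSq_conv_single] using ih
    | none =>
      have hsum := sum_wordLaw (sum_toReal_pmf μ) w
      have hnn := wordLaw_nonneg (q := fun x => (μ x).toReal) (fun x => ENNReal.toReal_nonneg) w
      have hsum' := sum_wordLaw (sum_toReal_pmf μ) (none :: w)
      simp only [wordLaw] at hsum' ⊢
      set p := wordLaw (fun x => (μ x).toReal) w with hp
      set p' := conv p (fun x => (μ x).toReal) with hp'
      have hnonneg : ∀ r : G → ℝ, ∑ x, r x = 1 → 0 ≤ chiSq r := fun r hr => by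
        refine nonneg_of_mul_nonneg_left (b := (Fintype.card G : ℝ)) ?_ hn
        rw [← sum_sq_sub_one r hr]
        exact Finset.sum_nonneg fun _ _ => sq_nonneg _
      have hmono : chiSq p' ≤ chiSq p := by
        have h := sum_sq_step_le (fun x y : G => (μ (x⁻¹ * y)).toReal)
          (fun _ _ => ENNReal.toReal_nonneg)
          (fun x => by
            rw [← sum_toReal_pmf μ]
            exact Fintype.sum_equiv (Equiv.mulLeft x⁻¹) _ _ fun _ => rfl)
          (fun y => by
            rw [← sum_toReal_pmf μ]
            exact Fintype.sum_equiv ((Equiv.inv G).trans (Equiv.mulRight y)) _ _ fun _ => rfl)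
          0 (fun _ => ENNReal.toReal_nonneg) p
        rw [zero_mul, sub_zero] at h
        simp only [chiSq, hp', conv]
        exact sub_le_sub_right (mul_le_mul_of_nonneg_left h hn.le) _
      refine ⟨hmono.trans_lt ih.1, fun hpos => ?_⟩
      have hpos' := hpos.trans_le hmono
      -- Successive random letters use adjacent intervals, so their contributions add. Positivity of
      -- `chiSq p'` is essential here, as `4 / 0 = 0`.
      have hunion : Set.Ico (4 / (Fintype.card G : ℝ)) (4 / chiSq p') =
          Set.Ico (4 / (Fintype.card G : ℝ)) (4 / chiSq p) ∪
            Set.Ico (4 / chiSq p) (4 / chiSq p') := by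
        rw [Set.Ico_union_Ico_eq_Ico]
        · exact div_le_div_of_nonneg_left (by norm_num) hpos' ih.1.le
        · exact div_le_div_of_nonneg_left (by norm_num) hpos hmono
      rw [hunion, lintegral_union measurableSet_Ico
        (Set.disjoint_left.2 fun u hu hu' => absurd hu.2 (not_lt.2 hu'.1)),
        List.count_cons_self, Nat.cast_add, mul_add, Nat.cast_one, mul_one]
      exact add_le_add (ih.2 hpos') (ofReal_le_lintegral_Ico μ hpos ih.1
        (chiSq_conv_pmf_le μ hμ₀ hμ p hnn hsum hpos') hmono hΦ)

end Word

/-! ### Conditioning on one of two independent variables. -/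

section Independence

variable {Ω : Type*} [MeasurableSpace Ω] {P : Measure Ω}

/-- If `A` is independent of `(B, C)` and `B` is independent of `C`, then `(A, B)` is independent
of `C`. -/
theorem IndepFun.prodMk_left_of_prodMk_right [IsProbabilityMeasure P] {α β γ : Type*}
    [MeasurableSpace α] [MeasurableSpace β] [MeasurableSpace γ]
    {A : Ω → α} {B : Ω → β} {C : Ω → γ} (hA : Measurable A) (hB : Measurable B)
    (hC : Measurable C) (h : IndepFun A (fun ω => (B ω, C ω)) P) (hBC : IndepFun B C P) :
    IndepFun (fun ω => (A ω, B ω)) C P := by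
  have hAB : IndepFun A B P := h.comp measurable_id measurable_fst
  have := Measure.isProbabilityMeasure_map (μ := P) hA.aemeasurable
  have := Measure.isProbabilityMeasure_map (μ := P) hB.aemeasurable
  have := Measure.isProbabilityMeasure_map (μ := P) hC.aemeasurable
  rw [indepFun_iff_map_prod_eq_prod_map_map (hA.prodMk hB).aemeasurable hC.aemeasurable,
    hAB.map_prod_eq_prod_map_map hA.aemeasurable hB.aemeasurable]
  have h1 := h.map_prod_eq_prod_map_map hA.aemeasurable (hB.prodMk hC).aemeasurable
  rw [hBC.map_prod_eq_prod_map_map hB.aemeasurable hC.aemeasurable,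
    ← Measure.prodAssoc_prod] at h1
  have h2 := congrArg (Measure.map MeasurableEquiv.prodAssoc.symm) h1
  rw [MeasurableEquiv.map_symm_map, Measure.map_map MeasurableEquiv.prodAssoc.symm.measurable
    (hA.prodMk (hB.prodMk hC))] at h2
  exact h2

/-- If the pairs `(f j, g j)` are independent and `f j` is independent of `g j` for each `j`,
then the vectors `f` and `g` are independent. -/
theorem iIndepFun.indepFun_pi_pi {ι : Type*} [Fintype ι] {α β : Type*}
    [MeasurableSpace α] [MeasurableSpace β] {f : ι → Ω → α} {g : ι → Ω → β}
    (hf : ∀ j, Measurable (f j)) (hg : ∀ j, Measurable (g j))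
    (h : iIndepFun (fun j ω => (f j ω, g j ω)) P) (hfg : ∀ j, IndepFun (f j) (g j) P) :
    IndepFun (fun ω j => f j ω) (fun ω j => g j ω) P := by
  have := h.isProbabilityMeasure
  have hf' : iIndepFun f P := h.comp (fun _ => Prod.fst) (fun _ => measurable_fst)
  have hg' : iIndepFun g P := h.comp (fun _ => Prod.snd) (fun _ => measurable_snd)
  have := fun j => Measure.isProbabilityMeasure_map (μ := P) (hf j).aemeasurable
  have := fun j => Measure.isProbabilityMeasure_map (μ := P) (hg j).aemeasurable
  rw [indepFun_iff_map_prod_eq_prod_map_map (measurable_pi_lambda _ hf).aemeasurable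
    (measurable_pi_lambda _ hg).aemeasurable,
    hf'.map_fun_eq_pi_map (fun j => (hf j).aemeasurable),
    hg'.map_fun_eq_pi_map (fun j => (hg j).aemeasurable),
    ← (measurePreserving_arrowProdEquivProdArrow α β ι (fun j => P.map (f j))
      (fun j => P.map (g j))).map_eq]
  have h1 := h.map_fun_eq_pi_map (fun j => ((hf j).prodMk (hg j)).aemeasurable)
  have h2 : (fun j => P.map (fun ω => (f j ω, g j ω))) =
      fun j => (P.map (f j)).prod (P.map (g j)) := by
    funext j
    exact (hfg j).map_prod_eq_prod_map_map (hf j).aemeasurable (hg j).aemeasurable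
  rw [h2] at h1
  rw [← h1, Measure.map_map (MeasurableEquiv.measurable _)
    (measurable_pi_lambda _ fun j => (hf j).prodMk (hg j))]
  rfl

/-- Fubini for the product law; a second sample point `ω'` of the same space plays the independent
copy. -/
theorem lintegral_comp_of_indepFun [IsProbabilityMeasure P] {α β : Type*}
    [MeasurableSpace α] [MeasurableSpace β] {f : Ω → α} {g : Ω → β} (hf : Measurable f)
    (hg : Measurable g) (hfg : IndepFun f g P) {H : α × β → ℝ≥0∞} (hH : Measurable H) :
    ∫⁻ ω, H (f ω, g ω) ∂P = ∫⁻ ω, ∫⁻ ω', H (f ω, g ω') ∂P ∂P := by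
  have := Measure.isProbabilityMeasure_map (μ := P) hg.aemeasurable
  rw [← lintegral_map (f := H) hH (hf.prodMk hg),
    hfg.map_prod_eq_prod_map_map hf.aemeasurable hg.aemeasurable, lintegral_prod _ hH.aemeasurable,
    lintegral_map hH.lintegral_prod_right' hf]
  refine lintegral_congr fun ω => ?_
  exact lintegral_map (f := fun y => H (f ω, y)) (hH.comp measurable_prodMk_left) hg

/-- The law of `F (f, g)` with `f`, `g` independent is as close to uniform as the laws of
`F (a, g)`, up to the probability of the exceptional values `a ∈ B`. -/
theorem abs_mul_sub_one_le_of_indepFun [IsProbabilityMeasure P] {α β : Type*}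
    [MeasurableSpace α] [DiscreteMeasurableSpace α] [MeasurableSpace β]
    {f : Ω → α} {g : Ω → β} (hf : Measurable f)
    (hg : Measurable g) (hfg : IndepFun f g P) {A : Set (α × β)} (hA : MeasurableSet A)
    (B : Set α) {n δ : ℝ} (hn : 1 ≤ n) (hδ : 0 ≤ δ)
    (h : ∀ a, a ∉ B → |P.real {ω | (a, g ω) ∈ A} * n - 1| ≤ δ) :
    |P.real {ω | (f ω, g ω) ∈ A} * n - 1| ≤ δ + n * P.real {ω | f ω ∈ B} := by
  set k : α → ℝ := fun a => P.real {ω | (a, g ω) ∈ A} with hk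
  have hAa : ∀ a, MeasurableSet {ω | (a, g ω) ∈ A} := fun a =>
    (measurable_const.prodMk hg) hA
  have h1 : P.real {ω | (f ω, g ω) ∈ A} = ∫ ω, k (f ω) ∂P := by
    have := lintegral_comp_of_indepFun hf hg hfg (measurable_one.indicator hA)
    rw [integral_eq_lintegral_of_nonneg_ae (ae_of_all _ fun ω => measureReal_nonneg)
      ((Measurable.of_discrete (f := k)).comp hf).aestronglyMeasurable]
    have e1 : ∫⁻ ω, A.indicator 1 (f ω, g ω) ∂P = P {ω | (f ω, g ω) ∈ A} :=
      lintegral_indicator_one ((hf.prodMk hg) hA)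
    have e2 : ∀ a, ∫⁻ ω, A.indicator 1 (a, g ω) ∂P = ENNReal.ofReal (k a) := fun a => by
      rw [hk, ofReal_measureReal]
      exact lintegral_indicator_one (hAa a)
    simp only [e1, e2] at this
    rw [Measure.real, this]
  have hint : Integrable (fun ω => k (f ω)) P := by
    refine Integrable.of_bound ((Measurable.of_discrete (f := k)).comp hf).aestronglyMeasurable 1
      (ae_of_all _ fun ω => ?_)
    rw [Real.norm_of_nonneg measureReal_nonneg]
    exact measureReal_le_one
  have hB : MeasurableSet {ω | f ω ∈ B} := hf (MeasurableSet.of_discrete (s := B))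
  have h2 : P.real {ω | (f ω, g ω) ∈ A} * n - 1 = ∫ ω, (k (f ω) * n - 1) ∂P := by
    rw [h1, integral_sub (hint.mul_const n) (integrable_const _), integral_mul_const]
    simp
  have hbound : ∀ ω, |k (f ω) * n - 1| ≤ δ + {ω | f ω ∈ B}.indicator (fun _ => n) ω := by
    intro ω
    by_cases hω : f ω ∈ B
    -- On the exceptional set only `0 ≤ k ≤ 1` is known, and `|k n - 1| ≤ n` because `n ≥ 1`.
    · rw [Set.indicator_of_mem (s := {ω | f ω ∈ B}) hω]
      have h0 : 0 ≤ k (f ω) := measureReal_nonneg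
      have h1 : k (f ω) ≤ 1 := measureReal_le_one
      rw [abs_le]
      constructor <;> nlinarith
    · rw [Set.indicator_of_notMem (s := {ω | f ω ∈ B}) hω, add_zero]
      exact h _ hω
  rw [h2]
  refine (abs_integral_le_integral_abs).trans ?_
  refine (integral_mono ((hint.mul_const n).sub (integrable_const _)).abs
    ((integrable_const δ).add ((integrable_const n).indicator hB)) hbound).trans (le_of_eq ?_)
  simp only [Pi.add_apply]
  rw [integral_add (integrable_const δ) ((integrable_const n).indicator hB),
    integral_indicator_const _ hB]
  simp [mul_comm]

end Independence

/-! ### Ordered products in which some factors are frozen. -/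

section PartialProduct

variable {G : Type*}

/-- The word whose letters at the times in `I` are `none` and are the constants `c` elsewhere. -/
def fillWord (I : Finset ℕ) (c : ℕ → G) : ℕ → List (Option G)
  | 0 => []
  | n + 1 => (if n + 1 ∈ I then none else some (c (n + 1))) :: fillWord I c n

theorem count_fillWord [DecidableEq G] (I : Finset ℕ) (c : ℕ → G) (n : ℕ) :
    (fillWord I c n).count none = (I ∩ Finset.Icc 1 n).card := by
  induction n with
  | zero => simp [fillWord]
  | succ n ih =>
    have h : Finset.Icc 1 (n + 1) = insert (n + 1) (Finset.Icc 1 n) := by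
      ext j; simp only [Finset.mem_Icc, Finset.mem_insert]; omega
    by_cases hn : n + 1 ∈ I
    · rw [fillWord, if_pos hn, List.count_cons_self, ih, h, Finset.inter_insert_of_mem hn,
        Finset.card_insert_of_notMem (by simp)]
    · rw [fillWord, if_neg hn, h, Finset.inter_insert_of_notMem hn,
        List.count_cons_of_ne (by simp), ih]

variable [Group G]

/-- The ordered product `z 1 * ⋯ * z n`. -/
def partialProd (z : ℕ → G) : ℕ → G
  | 0 => 1
  | n + 1 => partialProd z n * z (n + 1)

theorem partialProd_congr {z z' : ℕ → G} {n : ℕ} (h : ∀ j, 1 ≤ j → j ≤ n → z j = z' j) :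
    partialProd z n = partialProd z' n := by
  induction n with
  | zero => rfl
  | succ n ih =>
    simp only [partialProd]
    rw [ih fun j h1 h2 => h j h1 (h2.trans n.le_succ), h (n + 1) (by omega) le_rfl]

variable [Fintype G] [MeasurableSpace G] [DiscreteMeasurableSpace G]

theorem measurable_partialProd_fill {Ω : Type*} {m : MeasurableSpace Ω} {Y : ℕ → Ω → G} {n : ℕ}
    (hY : ∀ j ≤ n, Measurable[m] (Y j)) (I : Finset ℕ) (c : ℕ → G) :
    Measurable[m] fun ω => partialProd (fun j => if j ∈ I then Y j ω else c j) n := by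
  induction n with
  | zero => exact measurable_const
  | succ n ih =>
    simp only [partialProd]
    have h1 := ih fun j hj => hY j (hj.trans n.le_succ)
    have h2 : Measurable[m] fun ω => if n + 1 ∈ I then Y (n + 1) ω else c (n + 1) := by
      by_cases h : n + 1 ∈ I
      · simpa only [h, if_true] using hY _ le_rfl
      · simp only [h, if_false]; exact measurable_const
    exact (Measurable.of_discrete (f := fun p : G × G => p.1 * p.2)).comp (h1.prodMk h2)

variable [DecidableEq G] {Ω : Type*} [MeasurableSpace Ω] {P : Measure Ω}

/-- Products of independent factors have the law of the corresponding word. -/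
theorem measureReal_partialProd_fill_eq {Y : ℕ → Ω → G} (hY : ∀ j, Measurable (Y j))
    (hind : iIndepFun Y P) (μ : PMF G) (I : Finset ℕ)
    (hlaw : ∀ j ∈ I, ∀ g, P {ω | Y j ω = g} = μ g) (c : ℕ → G) (n : ℕ) (x : G) :
    P.real {ω | partialProd (fun j => if j ∈ I then Y j ω else c j) n = x} =
      wordLaw (fun x => (μ x).toReal) (fillWord I c n) x := by
  have := hind.isProbabilityMeasure
  induction n generalizing x with
  | zero =>
    by_cases h : 1 = x
    · simp [partialProd, fillWord, wordLaw, ← h]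
    · simp [partialProd, fillWord, wordLaw, h, Ne.symm h]
  | succ n ih =>
    by_cases hn : n + 1 ∈ I
    · simp only [partialProd, hn, if_true, fillWord, wordLaw, conv]
      set T : Ω → G := fun ω => partialProd (fun j => if j ∈ I then Y j ω else c j) n with hT
      -- `T` is measurable with respect to the samples up to time `n`.
      have hTY : IndepFun T (Y (n + 1)) P := by
        set σ : ℕ → MeasurableSpace Ω := fun j => MeasurableSpace.comap (Y j) inferInstance with hσ
        have h1 : Indep (⨆ j ∈ Set.Iic n, σ j) (⨆ j ∈ ({n + 1} : Set ℕ), σ j) P :=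
          indep_iSup_of_disjoint (fun j => (hY j).comap_le) hind.iIndep (by simp)
        have h2 : Measurable[⨆ j ∈ Set.Iic n, σ j] T := by
          refine measurable_partialProd_fill (fun j hj => ?_) I c
          have hle : σ j ≤ ⨆ j ∈ Set.Iic n, σ j := le_iSup₂ (f := fun j (_ : j ∈ Set.Iic n) => σ j) j hj
          exact (comap_measurable (Y j)).mono hle le_rfl
        have h3 : σ (n + 1) ≤ ⨆ j ∈ ({n + 1} : Set ℕ), σ j :=
          le_iSup₂ (f := fun j (_ : j ∈ ({n + 1} : Set ℕ)) => σ j) (n + 1) rfl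
        have h4 : MeasurableSpace.comap T inferInstance ≤ ⨆ j ∈ Set.Iic n, σ j :=
          measurable_iff_comap_le.1 h2
        exact (IndepFun_iff_Indep _ _ _).2
          (indep_of_indep_of_le_left (indep_of_indep_of_le_right h1 h3) h4)
      have hTm : Measurable T := measurable_partialProd_fill (fun j _ => hY j) I c
      have hset : {ω | T ω * Y (n + 1) ω = x} =
          ⋃ z : G, (T ⁻¹' {z} ∩ Y (n + 1) ⁻¹' {z⁻¹ * x}) := by
        ext ω
        simp [← eq_inv_mul_iff_mul_eq]
      rw [hset, measureReal_iUnion_fintype]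
      · refine Finset.sum_congr rfl fun z _ => ?_
        rw [Measure.real, hTY.measure_inter_preimage_eq_mul _ _ (measurableSet_singleton _)
          (measurableSet_singleton _), ENNReal.toReal_mul, ← ih z, ← hlaw _ hn]
        rfl
      · intro z z' hz
        refine Set.disjoint_left.2 fun ω h1 h2 => hz ?_
        exact h1.1.symm.trans h2.1
      · intro z
        exact (hTm (measurableSet_singleton _)).inter (hY _ (measurableSet_singleton _))
    · simp only [partialProd, hn, if_false, fillWord, wordLaw]
      rw [conv_single, ← ih]
      simp only [eq_mul_inv_iff_mul_eq]

/-- If in the product `Y (r 1) ⋯ Y (r n)` each variable `Y i`, `i ∈ I`, occurs exactly once, at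
position `i`, then its law is as close to uniform as the laws of the words whose random letters
are at the positions in `I`. -/
theorem abs_partialProd_comp_sub_one_le {Y : ℕ → Ω → G} (hY : ∀ j, Measurable (Y j))
    (hind : iIndepFun Y P) (μ : PMF G) (I : Finset ℕ)
    (hlaw : ∀ j ∈ I, ∀ g, P {ω | Y j ω = g} = μ g) {r : ℕ → ℕ} {n : ℕ}
    (hr : ∀ i ∈ I, ∀ j, 1 ≤ j → j ≤ n → (r j = i ↔ j = i)) {δ : ℝ} (hδ : 0 ≤ δ) (x : G)
    (h : ∀ c : ℕ → G, |wordLaw (fun x => (μ x).toReal) (fillWord I c n) x *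
      Fintype.card G - 1| ≤ δ) :
    |P.real {ω | partialProd (fun j => Y (r j) ω) n = x} * Fintype.card G - 1| ≤ δ := by
  have := hind.isProbabilityMeasure
  -- `J` indexes the samples to be frozen. A position outside `I` has its root in `J`, so the
  -- default `1` in `F` is never reached at positions `1, …, n`.
  set J : Finset ℕ := (Finset.Icc 1 n).image r \ I with hJ
  set F : (J → G) × (I → G) → G := fun p => partialProd (fun j =>
    if h : j ∈ I then p.2 ⟨j, h⟩ else if h : r j ∈ J then p.1 ⟨r j, h⟩ else 1) n with hF
  have hJI : IndepFun (fun ω (i : J) => Y i ω) (fun ω (i : I) => Y i ω) P :=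
    hind.indepFun_finset J I Finset.sdiff_disjoint hY
  have hmain := abs_mul_sub_one_le_of_indepFun (P := P)
    (f := fun ω (i : J) => Y i ω) (g := fun ω (i : I) => Y i ω)
    (measurable_pi_lambda _ fun i => hY i) (measurable_pi_lambda _ fun i => hY i) hJI
    (A := F ⁻¹' {x}) MeasurableSet.of_discrete ∅ (n := Fintype.card G)
    (by exact_mod_cast Fintype.card_pos) hδ (by
      intro a _
      have := h fun j => if h : r j ∈ J then a ⟨r j, h⟩ else 1
      rw [← measureReal_partialProd_fill_eq hY hind μ I hlaw] at this
      convert this using 6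
      simp [hF])
  simp only [Set.mem_empty_iff_false, Set.ofPred_false, measureReal_empty, mul_zero,
    add_zero] at hmain
  have hprod : ∀ ω, partialProd (fun j => Y (r j) ω) n =
      F (fun i : J => Y i ω, fun i : I => Y i ω) := by
    intro ω
    refine partialProd_congr fun j hj1 hj2 => ?_
    by_cases hjI : j ∈ I
    · simp only [hjI, dif_pos]
      rw [(hr j hjI j hj1 hj2).2 rfl]
    · have hrj : r j ∈ J := by
        refine Finset.mem_sdiff.2 ⟨Finset.mem_image_of_mem r (Finset.mem_Icc.2 ⟨hj1, hj2⟩),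
          fun hI => hjI ?_⟩
        rw [(hr _ hI j hj1 hj2).1 rfl]
        exact hI
      simp [hjI, hrj]
  simp only [hprod]
  exact hmain

end PartialProduct

/-! ### Repetition trees and the number of single times. -/

section Singles

/-- The time at which the step used at time `j` was sampled, when `a` tells which steps are
repetitions and `b` which step is repeated. -/
def rootTime (a : ℕ → Bool) (b : ℕ → ℕ) (j : ℕ) : ℕ :=
  -- The test `b j < j` is for termination; it always holds for the selections of the walk.
  if _h : 2 ≤ j ∧ a j = true ∧ b j < j then rootTime a b (b j) else j
termination_by j

theorem rootTime_le (a : ℕ → Bool) (b : ℕ → ℕ) (j : ℕ) : rootTime a b j ≤ j := by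
  induction j using Nat.strong_induction_on with
  | _ j ih =>
    rw [rootTime]
    split_ifs with h
    · exact (ih _ h.2.2).trans h.2.2.le
    · exact le_rfl

theorem rootTime_congr {a a' : ℕ → Bool} {b b' : ℕ → ℕ} {n : ℕ}
    (ha : ∀ i ≤ n, a i = a' i) (hb : ∀ i ≤ n, b i = b' i) {j : ℕ} (hj : j ≤ n) :
    rootTime a b j = rootTime a' b' j := by
  induction j using Nat.strong_induction_on with
  | _ j ih =>
    rw [rootTime, rootTime.eq_1 a']
    simp only [ha j hj, hb j hj]
    split_ifs with h
    · exact ih _ h.2.2 (h.2.2.le.trans hj)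
    · rfl

/-- The fresh times in the window `W` that are never selected from inside `W`. -/
def singleTimes (W : Finset ℕ) (a : ℕ → Bool) (b : ℕ → ℕ) : Finset ℕ :=
  W.filter fun i => (∀ j ∈ W, b j ≠ i) ∧ a i = false

/-- A chain of repetitions descends in time. To end at `i` from `j ≠ i`, its last jump would select
`i` from a time in `(i, n]`, which lies in the window, contrary to singleness; and `i` is its own
root because it is fresh. -/
theorem rootTime_eq_iff_of_mem_singleTimes {m n : ℕ} {a : ℕ → Bool} {b : ℕ → ℕ} {i j : ℕ}
    (hi : i ∈ singleTimes (Finset.Ioc m n) a b) (hj : j ≤ n) : rootTime a b j = i ↔ j = i := by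
  simp only [singleTimes, Finset.mem_filter, Finset.mem_Ioc] at hi
  obtain ⟨⟨hmi, hin⟩, hib, hia⟩ := hi
  constructor
  · induction j using Nat.strong_induction_on with
    | _ j ih =>
      intro h
      have hle : i ≤ j := h ▸ rootTime_le a b j
      rw [rootTime] at h
      split_ifs at h with hc
      · exact absurd (ih _ hc.2.2 (hc.2.2.le.trans hj) h) (hib j ⟨by omega, hj⟩)
      · exact h
  · rintro rfl
    rw [rootTime, dif_neg]
    simp [hia]

/-- The selected points of `W` are images of the times whose selection lands in `W`, so there are no
more of them than such times; take complements. The right side is awkward for product formulas,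
while the left side is a sum of indicators of separate `b j`. -/
theorem card_filter_notMem_le (W : Finset ℕ) (b : ℕ → ℕ) :
    (W.filter fun j => b j ∉ W).card ≤ (W.filter fun i => ∀ j ∈ W, b j ≠ i).card := by
  have h1 := Finset.card_filter_add_card_filter_not (s := W) (fun j => b j ∈ W)
  have h2 := Finset.card_filter_add_card_filter_not (s := W) (fun i => ∀ j ∈ W, b j ≠ i)
  have h3 : (W.filter fun i => ¬ ∀ j ∈ W, b j ≠ i).card ≤ (W.filter fun j => b j ∈ W).card := by
    refine (Finset.card_le_card ?_).trans (Finset.card_image_le (f := b))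
    intro i hi
    simp only [Finset.mem_filter, not_forall, not_not] at hi
    obtain ⟨hiW, j, hj, rfl⟩ := hi
    exact Finset.mem_image_of_mem b (Finset.mem_filter.2 ⟨hj, hiW⟩)
  omega

theorem partialProd_rootTime {G : Type*} [Group G] {Y X : ℕ → G} {S : ℕ → G} {a : ℕ → Bool}
    {b : ℕ → ℕ} (hb : ∀ n, 2 ≤ n → 1 ≤ b n ∧ b n ≤ n - 1) (h1 : X 1 = Y 1)
    (hX : ∀ n, 2 ≤ n → X n = if a n = true then X (b n) else Y n)
    (h0 : S 0 = 1) (hS : ∀ n, S (n + 1) = S n * X (n + 1)) (n : ℕ) :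
    S n = partialProd (fun j => Y (rootTime a b j)) n := by
  have key : ∀ j, 1 ≤ j → X j = Y (rootTime a b j) := by
    intro j
    induction j using Nat.strong_induction_on with
    | _ j ih =>
      intro hj
      rw [rootTime]
      by_cases hj2 : 2 ≤ j
      · have := hb j hj2
        have hlt : b j < j := by omega
        rw [hX j hj2]
        by_cases ha : a j = true
        · rw [if_pos ha, dif_pos ⟨hj2, ha, hlt⟩]
          exact ih _ hlt this.1
        · rw [if_neg ha, dif_neg fun h => ha h.2.1]
      · obtain rfl : j = 1 := by omega
        simpa using h1
  induction n with
  | zero => simpa [partialProd] using h0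
  | succ n ih => rw [hS, ih, key _ (by omega)]; rfl

variable {Ω : Type*} [MeasurableSpace Ω] {P : Measure Ω}

theorem lintegral_ite_le [IsProbabilityMeasure P] {A : Set Ω} [DecidablePred (· ∈ A)]
    (hA : MeasurableSet A) {c p : ℝ} (hc0 : 0 ≤ c) (hc1 : c ≤ 1) (hp : P.real A ≤ p) :
    ∫⁻ ω, (if ω ∈ A then 1 else ENNReal.ofReal c) ∂P ≤ ENNReal.ofReal (c + (1 - c) * p) := by
  have h1 : ∀ ω, (if ω ∈ A then 1 else ENNReal.ofReal c) =
      ENNReal.ofReal c + A.indicator (fun _ => ENNReal.ofReal (1 - c)) ω := by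
    intro ω
    by_cases h : ω ∈ A
    · rw [if_pos h, Set.indicator_of_mem h, ← ENNReal.ofReal_add hc0 (sub_nonneg.2 hc1)]
      simp
    · rw [if_neg h, Set.indicator_of_notMem h, add_zero]
  simp only [h1]
  rw [lintegral_add_left measurable_const, lintegral_indicator_const hA, lintegral_const,
    measure_univ, mul_one, ← ofReal_measureReal (μ := P), ← ENNReal.ofReal_mul (sub_nonneg.2 hc1),
    ← ENNReal.ofReal_add hc0 (mul_nonneg (sub_nonneg.2 hc1) measureReal_nonneg)]
  exact ENNReal.ofReal_le_ofReal
    (add_le_add_right (mul_le_mul_of_nonneg_left hp (sub_nonneg.2 hc1)) c)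

open Classical in
/-- Exponential moment of the number of times `i ∈ W` with `a i = false` that avoid the values of
`b` on `W`. -/
theorem lintegral_half_pow_singleTimes_le [IsProbabilityMeasure P] {N : ℕ} {W : Finset ℕ}
    (hW : ∀ i ∈ W, i < N) {ξ : ℕ → Ω → Bool} {u : ℕ → Ω → ℕ}
    (hξ : ∀ n, Measurable (ξ n)) (hu : ∀ n, Measurable (u n))
    (hξi : iIndepFun ξ P) (hui : iIndepFun u P)
    (hξu : IndepFun (fun ω (j : Fin N) => ξ j ω) (fun ω (j : Fin N) => u j ω) P)
    {α : ℝ} (hα : 0 ≤ α) (hα1 : α ≤ 1)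
    (hlaw : ∀ i ∈ W, P.real {ω | ξ i ω = true} ≤ α)
    (hlawu : ∀ j ∈ W, P.real {ω | u j ω ∈ W} ≤ 1 / 2) :
    ∫⁻ ω, ENNReal.ofReal (1 / 2) ^
        (singleTimes W (fun i => ξ i ω) (fun i => u i ω)).card ∂P ≤
      ENNReal.ofReal (1 - (1 - α) / 4) ^ W.card := by
  set ext1 : (Fin N → Bool) → ℕ → Bool := fun a i => if h : i < N then a ⟨i, h⟩ else false
    with hext1
  set ext2 : (Fin N → ℕ) → ℕ → ℕ := fun a i => if h : i < N then a ⟨i, h⟩ else 0 with hext2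
  have single_congr : ∀ a a' b b', (∀ i ∈ W, a i = a' i) → (∀ i ∈ W, b i = b' i) →
      singleTimes W a b = singleTimes W a' b' := by
    intro a a' b b' ha hb
    refine Finset.filter_congr fun i hi => ?_
    rw [ha i hi]
    refine and_congr_left fun _ => forall₂_congr fun j hj => ?_
    rw [hb j hj]
  set H : (Fin N → ℕ) × (Fin N → Bool) → ℝ≥0∞ := fun p =>
    ENNReal.ofReal (1 / 2) ^ (singleTimes W (ext1 p.2) (ext2 p.1)).card with hH
  have hreplace : ∀ ω ω', H (fun j => u j ω, fun j => ξ j ω') = ENNReal.ofReal (1 / 2) ^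
        (singleTimes W (fun i => ξ i ω') (fun i => u i ω)).card := by
    intro ω ω'
    simp only [hH]
    rw [single_congr (ext1 fun j => ξ j ω') (fun i => ξ i ω') (ext2 fun j => u j ω)
      (fun i => u i ω) (fun i hi => by simp [hext1, hW i hi]) (fun i hi => by simp [hext2, hW i hi])]
  have hL := lintegral_comp_of_indepFun (P := P) (measurable_pi_lambda _ fun j : Fin N => hu j)
    (measurable_pi_lambda _ fun j : Fin N => hξ j) hξu.symm (H := H) Measurable.of_discrete
  simp only [hreplace] at hL
  rw [hL]
  -- `t = (1 + α)/2` bounds the mean of the factor that equals `1` on a repetition and `1/2` on a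
  -- fresh step. Averaging `1` and `t` over the selections then gives at most `(1 + t)/2 = 1 - (1 -
  -- α)/4` per time.
  set t : ℝ := 1 / 2 + (1 - 1 / 2) * α with ht
  have ht0 : 0 ≤ t := by positivity
  have ht1 : t ≤ 1 := by rw [ht]; linarith
  -- For fixed selections, integrate the coins first. The bound `t ^ V.card` is then relaxed to a
  -- product over the independent `u j`.
  have hinner : ∀ ω, ∫⁻ ω', ENNReal.ofReal (1 / 2) ^
      (singleTimes W (fun i => ξ i ω') (fun i => u i ω)).card ∂P ≤
      ∏ j ∈ W, if u j ω ∈ W then 1 else ENNReal.ofReal t := by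
    intro ω
    set V := W.filter fun i => ∀ j ∈ W, u j ω ≠ i with hV
    have h1 : ∀ ω', ENNReal.ofReal (1 / 2) ^
        (singleTimes W (fun i => ξ i ω') (fun i => u i ω)).card =
        ∏ i ∈ V, if ξ i ω' = true then 1 else ENNReal.ofReal (1 / 2) := by
      intro ω'
      have : singleTimes W (fun i => ξ i ω') (fun i => u i ω) =
          V.filter fun i => ¬ ξ i ω' = true := by
        ext i; simp [singleTimes, hV, and_assoc]
      rw [this, Finset.prod_ite]
      simp
    simp only [h1]
    have hm : ∀ i, Measurable fun ω' => if ξ i ω' = true then 1 else ENNReal.ofReal (1 / 2) :=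
      fun i => (Measurable.of_discrete
        (f := fun b : Bool => if b = true then 1 else ENNReal.ofReal (1 / 2))).comp (hξ i)
    rw [lintegral_prod_eq_prod_lintegral_of_indepFun V
      (fun i ω' => if ξ i ω' = true then 1 else ENNReal.ofReal (1 / 2))
      (hξi.comp (fun _ (b : Bool) => if b = true then 1 else ENNReal.ofReal (1 / 2))
        fun _ => Measurable.of_discrete) hm]
    have h2 : ∏ i ∈ V, ∫⁻ ω', (if ξ i ω' = true then 1 else ENNReal.ofReal (1 / 2)) ∂P ≤
        ENNReal.ofReal t ^ V.card := by
      refine Finset.prod_le_pow_card _ _ _ fun i hi => ?_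
      exact lintegral_ite_le (A := {ω | ξ i ω = true}) (hξ i (measurableSet_singleton true))
        (by norm_num) (by norm_num) (hlaw i (Finset.mem_filter.1 hi).1)
    refine h2.trans ?_
    rw [Finset.prod_ite, Finset.prod_const_one, one_mul, Finset.prod_const]
    exact pow_le_pow_of_le_one zero_le (ENNReal.ofReal_le_one.2 ht1)
      (card_filter_notMem_le W fun j => u j ω)
  refine (lintegral_mono hinner).trans ?_
  rw [lintegral_prod_eq_prod_lintegral_of_indepFun W
    (fun j ω => if u j ω ∈ W then 1 else ENNReal.ofReal t)
    (hui.comp (fun _ (b : ℕ) => if b ∈ W then 1 else ENNReal.ofReal t)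
      fun _ => Measurable.of_discrete)
    (fun j => (Measurable.of_discrete
      (f := fun b : ℕ => if b ∈ W then 1 else ENNReal.ofReal t)).comp (hu j))]
  refine Finset.prod_le_pow_card _ _ _ fun j hj => ?_
  refine (lintegral_ite_le (A := {ω | u j ω ∈ W}) (hu j (MeasurableSet.of_discrete (s := {m : ℕ | m ∈ W})))
    ht0 ht1 (hlawu j hj)).trans (le_of_eq ?_)
  congr 1
  rw [ht]; ring

/-- Markov's inequality for `2^(-N)`. -/
theorem measureReal_lt_le_of_lintegral_half_pow [IsProbabilityMeasure P] {N : Ω → ℕ}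
    (hN : Measurable N) {s : ℝ} (hs : 0 ≤ s) {w : ℕ}
    (h : ∫⁻ ω, ENNReal.ofReal (1 / 2) ^ N ω ∂P ≤ ENNReal.ofReal s ^ w) (k : ℕ) :
    P.real {ω | N ω < k} ≤ 2 ^ k * s ^ w := by
  have h1 := mul_meas_ge_le_lintegral (μ := P) (f := fun ω => ENNReal.ofReal (1 / 2) ^ N ω)
    ((Measurable.of_discrete (f := fun m : ℕ => ENNReal.ofReal (1 / 2) ^ m)).comp hN)
    (ENNReal.ofReal (1 / 2) ^ k)
  have h2 : P {ω | N ω < k} ≤ P {ω | ENNReal.ofReal (1 / 2) ^ k ≤ ENNReal.ofReal (1 / 2) ^ N ω} :=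
    measure_mono fun ω hω => pow_le_pow_of_le_one zero_le
      (ENNReal.ofReal_le_one.2 (by norm_num)) (le_of_lt hω)
  have h3 := (mul_le_mul_right h2 (ENNReal.ofReal (1 / 2) ^ k)).trans (h1.trans h)
  rw [← ENNReal.ofReal_pow (by norm_num), ← ENNReal.ofReal_pow hs, ← ofReal_measureReal,
    ← ENNReal.ofReal_mul (by positivity), ENNReal.ofReal_le_ofReal_iff (by positivity)] at h3
  have h4 : (2 : ℝ) ^ k * (1 / 2) ^ k = 1 := by rw [← mul_pow]; norm_num
  calc P.real {ω | N ω < k} = 2 ^ k * ((1 / 2) ^ k * P.real {ω | N ω < k}) := by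
        rw [← mul_assoc, h4, one_mul]
    _ ≤ 2 ^ k * s ^ w := mul_le_mul_of_nonneg_left h3 (by positivity)

end Singles

/-! ### From random letters to mixing of the reinforced walk. -/

section Mixing

theorem List.exists_append_count_eq {β : Type*} [BEq β] [LawfulBEq β] (a : β) (l : List β) {k : ℕ}
    (hk : k ≤ l.count a) : ∃ l₁ l₂, l = l₁ ++ l₂ ∧ l₁.count a = k := by
  induction l generalizing k with
  | nil => exact ⟨[], [], rfl, by simp only [List.count_nil] at hk ⊢; omega⟩
  | cons b l ih =>
    rcases Nat.eq_zero_or_pos k with rfl | hk0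
    · exact ⟨[], b :: l, rfl, rfl⟩
    · by_cases hb : b = a
      · subst hb
        rw [List.count_cons_self] at hk
        obtain ⟨l₁, l₂, h1, h2⟩ := ih (k := k - 1) (by omega)
        exact ⟨b :: l₁, l₂, by rw [h1]; rfl, by rw [List.count_cons_self, h2]; omega⟩
      · rw [List.count_cons_of_ne hb] at hk
        obtain ⟨l₁, l₂, h1, h2⟩ := ih hk
        exact ⟨b :: l₁, l₂, by rw [h1]; rfl, by rw [List.count_cons_of_ne hb, h2]⟩

/-- Since `j ≤ n`, the window holds at most half of the `j - 1` candidates `1, …, j - 1`. -/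
theorem IsSRRWDrivenBy.measureReal_u_mem_Ioc_le {G : Type*} [Group G] [MeasurableSpace G]
    {Ω : Type*} [MeasurableSpace Ω] {P : Measure Ω} [IsProbabilityMeasure P] {μ : PMF G} {α : ℝ}
    {ξ : ℕ → Ω → Bool} {u : ℕ → Ω → ℕ} {Y X S : ℕ → Ω → G} (h : IsSRRWDrivenBy P μ α ξ u Y X S)
    {n : ℕ} (hn : 2 ≤ n) {j : ℕ} (hj : j ∈ Finset.Ioc (n - n / 2) n) :
    P.real {ω | u j ω ∈ Finset.Ioc (n - n / 2) n} ≤ 1 / 2 := by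
  rw [Finset.mem_Ioc] at hj
  have hj2 : 2 ≤ j := by omega
  have hset : {ω | u j ω ∈ Finset.Ioc (n - n / 2) n} ⊆
      ⋃ i ∈ Finset.Ioc (n - n / 2) (j - 1), {ω | u j ω = i} := by
    intro ω hω
    have h1 := h.u_mem j hj2 ω
    simp only [Set.mem_ofPred_eq, Finset.mem_Ioc] at hω
    simp only [Set.mem_iUnion, Finset.mem_Ioc, Set.mem_ofPred_eq]
    exact ⟨u j ω, ⟨hω.1, h1.2⟩, rfl⟩
  have hle : P.real {ω | u j ω ∈ Finset.Ioc (n - n / 2) n} ≤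
      ∑ i ∈ Finset.Ioc (n - n / 2) (j - 1), P.real {ω | u j ω = i} :=
    (measureReal_mono hset (measure_ne_top P _)).trans (measureReal_biUnion_finset_le _ _)
  have hval : ∀ i ∈ Finset.Ioc (n - n / 2) (j - 1),
      P.real {ω | u j ω = i} = ((j - 1 : ℕ) : ℝ)⁻¹ := by
    intro i hi
    rw [Finset.mem_Ioc] at hi
    rw [Measure.real, h.law_u j hj2 i (by omega) hi.2, ENNReal.toReal_inv, ENNReal.toReal_natCast]
  rw [Finset.sum_congr rfl hval, Finset.sum_const, Nat.card_Ioc, nsmul_eq_mul,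
    ← div_eq_mul_inv] at hle
  refine hle.trans ?_
  have hpos : (0 : ℝ) < ((j - 1 : ℕ) : ℝ) := by exact_mod_cast (by omega : 0 < j - 1)
  rw [div_le_iff₀ hpos]
  have : 2 * (j - 1 - (n - n / 2)) ≤ j - 1 := by omega
  have : (2 : ℝ) * ((j - 1 - (n - n / 2) : ℕ) : ℝ) ≤ ((j - 1 : ℕ) : ℝ) := by exact_mod_cast this
  linarith

variable {G : Type*} [Group G] [Fintype G] [DecidableEq G] [Nontrivial G]

/-- A word with sufficiently many `μ`-distributed letters is well mixed. -/
theorem abs_wordLaw_sub_one_le (μ : PMF G) {μ₀ : ℝ} (hμ₀ : 0 ≤ μ₀)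
    (hμ : ENNReal.ofReal μ₀ ≤ μ 1) (hΦ : isoperimetricProfile μ (1 / 2) ≠ 0)
    {δ : ℝ} (hδ : 0 < δ) {K : ℕ}
    (hK : ∫⁻ u in Set.Icc (4 / (Fintype.card G : ℝ)) (4 / δ),
        1 / (ENNReal.ofReal u * isoperimetricProfile μ u ^ 2) < ENNReal.ofReal (μ₀ / 8) * K)
    (w : List (Option G)) (hw : 2 * K ≤ w.count none) (x : G) :
    |wordLaw (fun x => (μ x).toReal) w x * Fintype.card G - 1| ≤ δ := by
  -- If `χ²` still exceeded `δ` after `K` random letters, these letters would have used up `(μ₀/8)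
  -- K`, more than the whole integral up to `4/δ`.
  have key : ∀ v : List (Option G), K ≤ v.count none →
      chiSq (wordLaw (fun x => (μ x).toReal) v) ≤ δ := by
    intro v hv
    by_contra! hlt
    have h1 := (mul_count_le_lintegral μ hμ₀ hμ hΦ v).2 (hδ.trans hlt)
    refine absurd hK (not_lt.2 (le_trans ?_ (h1.trans (lintegral_mono_set ?_))))
    · gcongr
    · intro u hu
      exact ⟨hu.1, hu.2.le.trans (div_le_div_of_nonneg_left (by norm_num) hδ hlt.le)⟩
  obtain ⟨l₁, l₂, rfl, h2⟩ := List.exists_append_count_eq none w (k := K) (by omega)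
  rw [List.count_append] at hw
  rw [wordLaw_append]
  exact abs_card_mul_conv_sub_one_le _ _ (sum_wordLaw (sum_toReal_pmf μ) _)
    (sum_wordLaw (sum_toReal_pmf μ) _) hδ.le (key _ (by omega)) (key _ (by omega)) x

/-- As `Φ ≤ 1`, the integrand is at least `1/u`. This is what pays for the factor `|G|` in the error
term. -/
theorem ofReal_log_le_lintegral (μ : PMF G) {b : ℝ} (hb : 4 / (Fintype.card G : ℝ) ≤ b) :
    ENNReal.ofReal (Real.log (b / (4 / (Fintype.card G : ℝ)))) ≤
      ∫⁻ u in Set.Icc (4 / (Fintype.card G : ℝ)) b,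
        1 / (ENNReal.ofReal u * isoperimetricProfile μ u ^ 2) := by
  have hn : (0 : ℝ) < Fintype.card G := by exact_mod_cast Fintype.card_pos
  have ha : 0 < 4 / (Fintype.card G : ℝ) := by positivity
  set a := 4 / (Fintype.card G : ℝ) with hadef
  have hint : IntegrableOn (fun u : ℝ => u⁻¹) (Set.Icc a b) :=
    (continuousOn_inv₀.mono fun u hu => (ha.trans_le hu.1).ne').integrableOn_Icc
  have h1 : Real.log (b / a) = ∫ u in Set.Icc a b, u⁻¹ := by
    rw [integral_Icc_eq_integral_Ioc, ← intervalIntegral.integral_of_le hb,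
      integral_inv_of_pos ha (ha.trans_le hb)]
  rw [h1, ofReal_integral_eq_lintegral_ofReal hint
    ((ae_restrict_iff' measurableSet_Icc).2 (ae_of_all _ fun u hu =>
      inv_nonneg.2 (ha.le.trans hu.1)))]
  refine setLIntegral_mono_ae' measurableSet_Icc (ae_of_all _ fun u hu => ?_)
  have hu0 : 0 < u := ha.trans_le hu.1
  rw [ENNReal.ofReal_inv_of_pos hu0, ← one_div]
  refine ENNReal.div_le_div_left ?_ 1
  have hle : isoperimetricProfile μ u ≤ 1 := by
    refine isoperimetricProfile_le_one μ (le_trans ?_ hu.1)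
    exact div_le_div_of_nonneg_right (by norm_num) hn.le
  calc ENNReal.ofReal u * isoperimetricProfile μ u ^ 2 ≤ ENNReal.ofReal u * 1 ^ 2 := by gcongr
    _ = ENNReal.ofReal u := by simp

theorem lintegral_eq_top_of_profile_eq_zero (μ : PMF G) {b : ℝ} (hb : 2 < b)
    (h : isoperimetricProfile μ (1 / 2) = 0) :
    ∫⁻ u in Set.Icc (4 / (Fintype.card G : ℝ)) b,
        1 / (ENNReal.ofReal u * isoperimetricProfile μ u ^ 2) = ⊤ := by
  have hn : (2 : ℝ) ≤ Fintype.card G := by exact_mod_cast Fintype.one_lt_card (α := G)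
  have hsub : Set.Icc 2 b ⊆ Set.Icc (4 / (Fintype.card G : ℝ)) b := by
    refine Set.Icc_subset_Icc_left ?_
    rw [div_le_iff₀ (by linarith)]
    linarith
  refine top_le_iff.1 (le_trans ?_ (lintegral_mono_set hsub))
  have : ∫⁻ _ in Set.Icc 2 b, (⊤ : ℝ≥0∞) ≤ ∫⁻ u in Set.Icc 2 b,
      1 / (ENNReal.ofReal u * isoperimetricProfile μ u ^ 2) := by
    refine setLIntegral_mono_ae' measurableSet_Icc (ae_of_all _ fun u hu => ?_)
    have h0 : isoperimetricProfile μ u = 0 :=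
      le_antisymm (h ▸ isoperimetricProfile_anti μ (by linarith [hu.1])) bot_le
    simp [h0]
  refine le_trans ?_ this
  rw [setLIntegral_const, Real.volume_Icc, ENNReal.top_mul]
  simpa using hb

variable [MeasurableSpace G] [DiscreteMeasurableSpace G] {Ω : Type*} [MeasurableSpace Ω]
  {P : Measure Ω}

/-- The law of the step-reinforced walk at time `n` is close to uniform if the laws of all words
with at least `k` `μ`-distributed letters are. -/
theorem IsSRRWDrivenBy.abs_measureReal_sub_one_le [IsProbabilityMeasure P] {μ : PMF G} {α : ℝ}
    (hα : 0 ≤ α) (hα1 : α < 1)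
    {ξ : ℕ → Ω → Bool} {u : ℕ → Ω → ℕ} {Y X S : ℕ → Ω → G} (h : IsSRRWDrivenBy P μ α ξ u Y X S)
    {n : ℕ} (hn : 2 ≤ n) {δ : ℝ} (hδ : 0 ≤ δ) {k : ℕ} (x : G)
    (hword : ∀ w : List (Option G), k ≤ w.count none →
      |wordLaw (fun x => (μ x).toReal) w x * Fintype.card G - 1| ≤ δ) :
    |P.real {ω | S n ω = x} * Fintype.card G - 1| ≤
      δ + Fintype.card G * (2 ^ k * (1 - (1 - α) / 4) ^ (n / 2)) := by
  set W := Finset.Ioc (n - n / 2) n with hW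
  have hcard : W.card = n / 2 := by rw [hW, Nat.card_Ioc]; omega
  have hWlt : ∀ i ∈ W, i < n + 1 := fun i hi => by
    rw [hW, Finset.mem_Ioc] at hi; omega
  have hξi : iIndepFun ξ P :=
    h.indep_times.comp (fun _ p => p.1) fun _ => measurable_fst
  have hui : iIndepFun u P :=
    h.indep_times.comp (fun _ p => p.2.1) fun _ => measurable_fst.comp measurable_snd
  have hYi : iIndepFun Y P :=
    h.indep_times.comp (fun _ p => p.2.2) fun _ => measurable_snd.comp measurable_snd
  have hξu : IndepFun (fun ω (j : Fin (n + 1)) => ξ j ω) (fun ω (j : Fin (n + 1)) => u j ω) P := by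
    refine iIndepFun.indepFun_pi_pi (fun j => h.measurable_ξ j) (fun j => h.measurable_u j) ?_
      fun j => (h.indep_ξ j).comp measurable_id measurable_fst
    exact (h.indep_times.precomp Fin.val_injective).comp (fun _ p => (p.1, p.2.1))
      fun _ => measurable_fst.prodMk (measurable_fst.comp measurable_snd)
  have hEY : IndepFun (fun ω (j : Fin (n + 1)) => (ξ j ω, u j ω))
      (fun ω (j : Fin (n + 1)) => Y j ω) P := by
    refine iIndepFun.indepFun_pi_pi (fun j => (h.measurable_ξ j).prodMk (h.measurable_u j))
      (fun j => h.measurable_Y j) ?_ fun j => IndepFun.prodMk_left_of_prodMk_right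
        (h.measurable_ξ j) (h.measurable_u j) (h.measurable_Y j) (h.indep_ξ j) (h.indep_u j)
    exact (h.indep_times.precomp Fin.val_injective).comp (fun _ p => ((p.1, p.2.1), p.2.2))
      fun _ => (measurable_fst.prodMk (measurable_fst.comp measurable_snd)).prodMk
        (measurable_snd.comp measurable_snd)
  -- `Fin.ofNat` reduces modulo `n + 1`, which is harmless since only indices up to `n` are read.
  -- Truncating in time makes the environment discrete, as conditioning requires.
  set ea : (Fin (n + 1) → Bool × ℕ) → ℕ → Bool := fun e i => (e (Fin.ofNat (n + 1) i)).1 with hea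
  set eb : (Fin (n + 1) → Bool × ℕ) → ℕ → ℕ := fun e i => (e (Fin.ofNat (n + 1) i)).2 with heb
  set f : Ω → Fin (n + 1) → Bool × ℕ := fun ω j => (ξ j ω, u j ω) with hf
  set g : Ω → Fin (n + 1) → G := fun ω j => Y j ω with hg
  have hfm : Measurable f :=
    measurable_pi_lambda _ fun j => (h.measurable_ξ j).prodMk (h.measurable_u j)
  have hgm : Measurable g := measurable_pi_lambda _ fun j => h.measurable_Y j
  have hfa : ∀ ω, ∀ i ≤ n, ea (f ω) i = ξ i ω := fun ω i hi => by
    simp [hea, hf, Nat.mod_eq_of_lt (Nat.lt_succ_of_le hi)]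
  have hfb : ∀ ω, ∀ i ≤ n, eb (f ω) i = u i ω := fun ω i hi => by
    simp [heb, hf, Nat.mod_eq_of_lt (Nat.lt_succ_of_le hi)]
  set F : (Fin (n + 1) → Bool × ℕ) × (Fin (n + 1) → G) → G := fun p =>
    partialProd (fun j => p.2 (Fin.ofNat (n + 1) (rootTime (ea p.1) (eb p.1) j))) n with hF
  have hgY : ∀ e ω, F (e, g ω) = partialProd (fun j => Y (rootTime (ea e) (eb e) j) ω) n := by
    intro e ω
    refine partialProd_congr fun j _ hj => ?_
    have := (rootTime_le (ea e) (eb e) j).trans hj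
    simp [hg, Nat.mod_eq_of_lt (Nat.lt_succ_of_le this)]
  have hS : ∀ ω, S n ω = F (f ω, g ω) := by
    intro ω
    rw [hgY, partialProd_rootTime (Y := fun j => Y j ω) (X := fun j => X j ω)
      (S := fun j => S j ω) (a := fun j => ξ j ω) (b := fun j => u j ω)
      (fun m hm => h.u_mem m hm ω) (h.step_one ω) (fun m hm => h.step m hm ω) (h.walk_zero ω)
      (fun m => h.walk_succ m ω) n]
    refine partialProd_congr fun j _ hj => ?_
    rw [rootTime_congr (fun i hi => (hfa ω i hi).symm) (fun i hi => (hfb ω i hi).symm) hj]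
  set B : Set (Fin (n + 1) → Bool × ℕ) := {e | (singleTimes W (ea e) (eb e)).card < k} with hB
  have hmix := abs_mul_sub_one_le_of_indepFun hfm hgm hEY (A := F ⁻¹' {x})
    MeasurableSet.of_discrete B (n := Fintype.card G) (by exact_mod_cast Fintype.card_pos) hδ (by
      intro e he
      have hek : k ≤ (singleTimes W (ea e) (eb e)).card := not_lt.1 he
      simp only [Set.mem_preimage, hgY]
      refine abs_partialProd_comp_sub_one_le h.measurable_Y hYi μ (singleTimes W (ea e) (eb e))
        (fun j hj => h.law_Y j ?_) (fun i hi j _ hj => rootTime_eq_iff_of_mem_singleTimes hi hj)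
        hδ x fun c => hword _ ?_
      · have := (Finset.mem_filter.1 hj).1
        rw [hW, Finset.mem_Ioc] at this
        omega
      · rw [count_fillWord, Finset.inter_eq_left.2]
        · exact hek
        · intro i hi
          have := (Finset.mem_filter.1 hi).1
          rw [hW, Finset.mem_Ioc] at this
          exact Finset.mem_Icc.2 ⟨by omega, this.2⟩)
  have hPB : P.real {ω | f ω ∈ B} ≤ 2 ^ k * (1 - (1 - α) / 4) ^ (n / 2) := by
    have hsing : ∀ ω, singleTimes W (ea (f ω)) (eb (f ω)) =
        singleTimes W (fun i => ξ i ω) (fun i => u i ω) := by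
      intro ω
      refine Finset.filter_congr fun i hi => ?_
      rw [hfa ω i (Nat.le_of_lt_succ (hWlt i hi))]
      refine and_congr_left fun _ => forall₂_congr fun j hj => ?_
      rw [hfb ω j (Nat.le_of_lt_succ (hWlt j hj))]
    have hmom := lintegral_half_pow_singleTimes_le (P := P) hWlt h.measurable_ξ h.measurable_u
      hξi hui hξu hα hα1.le (fun i hi => by
        rw [hW, Finset.mem_Ioc] at hi
        rw [Measure.real, h.law_ξ i (by omega), ENNReal.toReal_ofReal hα])
      (fun j hj => h.measureReal_u_mem_Ioc_le hn hj)
    rw [hcard] at hmom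
    simp only [← hsing] at hmom
    exact measureReal_lt_le_of_lintegral_half_pow
      ((Measurable.of_discrete (f := fun e => (singleTimes W (ea e) (eb e)).card)).comp hfm)
      (by linarith) hmom k
  simp only [hS]
  refine hmix.trans ?_
  gcongr

end Mixing

/-! ### Choice of constants and conclusion. -/

/-- Since `n / 2 ≥ n/3`, the power is at most `exp(-(1 - α)n/12) ≤ exp(-5I/c)`. The factor `2^(2K)`
costs at most `exp(2I/c + 2) ≤ exp(4I/c)`, and the remaining `exp(-I/c)` beats `2N/ε`. This is the
origin of 60. -/
theorem card_mul_two_pow_mul_le {N α ε I c : ℝ} (hN : 2 ≤ N) (hα1 : α < 1) (hα : 0 ≤ α)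
    (hε : 0 < ε) (hc0 : 0 < c) (hc1 : c ≤ 1) (hI : Real.log (2 * N / ε) ≤ I) (hI1 : 1 ≤ I)
    {K n : ℕ} (hK : (K : ℝ) ≤ I / c + 1) (hn : 60 * I / (c * (1 - α)) ≤ n) :
    N * (2 ^ (2 * K) * (1 - (1 - α) / 4) ^ (n / 2)) ≤ ε / 2 := by
  have hα' : 0 < 1 - α := by linarith
  have hIc : I ≤ I / c := by rw [le_div_iff₀ hc0]; nlinarith
  have hn' : 60 * (I / c) ≤ (1 - α) * n := by
    rw [div_le_iff₀ (by positivity)] at hn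
    rw [mul_div_assoc', div_le_iff₀ hc0]
    linarith
  have hn60 : (60 : ℝ) ≤ n := by
    have : (n : ℝ) * (1 - α) ≤ n := mul_le_of_le_one_right (Nat.cast_nonneg n) (by linarith)
    linarith
  have hw : (n : ℝ) / 3 ≤ ((n / 2 : ℕ) : ℝ) := by
    have h60 : 60 ≤ n := by exact_mod_cast hn60
    have : n ≤ 3 * (n / 2) := by omega
    have : (n : ℝ) ≤ 3 * ((n / 2 : ℕ) : ℝ) := by exact_mod_cast this
    linarith
  have h2 : (2 : ℝ) ^ (2 * K) ≤ Real.exp (2 * K) := by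
    have h2e : (2 : ℝ) ≤ Real.exp 1 := by linarith [Real.add_one_le_exp (1 : ℝ)]
    calc (2 : ℝ) ^ (2 * K) ≤ Real.exp 1 ^ (2 * K) := pow_le_pow_left₀ (by norm_num) h2e _
      _ = Real.exp (2 * K) := by rw [← Real.exp_nat_mul]; push_cast; ring_nf
  have h3 : (1 - (1 - α) / 4) ^ (n / 2) ≤ Real.exp (-((1 - α) * n / 12)) := by
    calc (1 - (1 - α) / 4) ^ (n / 2) ≤ Real.exp (-((1 - α) / 4)) ^ (n / 2) := by
          refine pow_le_pow_left₀ (by linarith) ?_ _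
          linarith [Real.add_one_le_exp (-((1 - α) / 4))]
      _ = Real.exp (-((1 - α) / 4 * ((n / 2 : ℕ) : ℝ))) := by
          rw [← Real.exp_nat_mul]; ring_nf
      _ ≤ Real.exp (-((1 - α) * n / 12)) := by
          refine Real.exp_le_exp.2 (neg_le_neg ?_)
          nlinarith [mul_le_mul_of_nonneg_left hw hα'.le]
  have hNε : 0 < 2 * N / ε := by positivity
  calc N * (2 ^ (2 * K) * (1 - (1 - α) / 4) ^ (n / 2))
      ≤ N * (Real.exp (2 * K) * Real.exp (-((1 - α) * n / 12))) := by
        refine mul_le_mul_of_nonneg_left (mul_le_mul h2 h3 ?_ (Real.exp_pos _).le) (by linarith)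
        exact pow_nonneg (by linarith) _
    _ ≤ N * Real.exp (-Real.log (2 * N / ε)) := by
        rw [← Real.exp_add]
        refine mul_le_mul_of_nonneg_left (Real.exp_le_exp.2 ?_) (by linarith)
        linarith
    _ = ε / 2 := by
        rw [Real.exp_neg, Real.exp_log hNε]
        field_simp

theorem proposition1p16 (μ₀ : ℝ) (hμ₀ : 0 < μ₀) (hμ₀' : μ₀ ≤ 1 / 2) :
    ∃ C : ℝ, 0 < C ∧
      ∀ (G : Type*) [Group G] [Fintype G] [DecidableEq G] [Nontrivial G]
        [MeasurableSpace G] [DiscreteMeasurableSpace G]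
        (μ : PMF G) (_hμ : ENNReal.ofReal μ₀ ≤ μ 1)
        (α : ℝ) (_hα : 0 ≤ α) (_hα' : α < 1)
        (Ω : Type*) [MeasurableSpace Ω] (P : Measure Ω) [IsProbabilityMeasure P]
        (S : ℕ → Ω → G) (_hS : IsSRRW P μ α S)
        (ε : ℝ) (_hε : 0 < ε) (_hε' : ε < 1),
        (uniformMixingTime P S ε : ℝ≥0∞) ≤
          ENNReal.ofReal (C / (1 - α)) *
            ∫⁻ u in Set.Icc (4 / (Fintype.card G : ℝ)) (8 / ε),
              1 / (ENNReal.ofReal u * isoperimetricProfile μ u ^ 2) := by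
  -- `μ₀/8` is the decay rate of `χ²`, 60 comes from `card_mul_two_pow_mul_le`, and one more unit
  -- absorbs the ceiling in `n₀`.
  refine ⟨61 / (μ₀ / 8), by positivity, ?_⟩
  intro G _ _ _ _ _ _ μ hμ α hα hα' Ω _ P _ S hS ε hε hε'
  obtain ⟨ξ, u, Y, X, hS⟩ := hS
  have hα1 : 0 < 1 - α := by linarith
  set c : ℝ := μ₀ / 8 with hc
  have hc0 : 0 < c := by positivity
  have hc1 : c ≤ 1 := by rw [hc]; linarith
  set I := ∫⁻ u in Set.Icc (4 / (Fintype.card G : ℝ)) (8 / ε),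
    1 / (ENNReal.ofReal u * isoperimetricProfile μ u ^ 2) with hI
  by_cases htop : I = ⊤
  · rw [htop, ENNReal.mul_top]
    · exact le_top
    · rw [Ne, ENNReal.ofReal_eq_zero, not_le]
      positivity
  have hN : (2 : ℝ) ≤ Fintype.card G := by exact_mod_cast Fintype.one_lt_card (α := G)
  have h8 : 8 < 8 / ε := by rw [lt_div_iff₀ hε]; linarith
  have hΦ : isoperimetricProfile μ (1 / 2) ≠ 0 := fun h =>
    htop (lintegral_eq_top_of_profile_eq_zero μ (by linarith) h)
  set J : ℝ := I.toReal with hJ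
  have hIJ : I = ENNReal.ofReal J := (ENNReal.ofReal_toReal htop).symm
  have h4 : 4 / (Fintype.card G : ℝ) ≤ 8 / ε := by
    have : 4 / (Fintype.card G : ℝ) ≤ 2 := by rw [div_le_iff₀ (by linarith)]; linarith
    linarith
  have hlog : Real.log (2 * Fintype.card G / ε) ≤ J := by
    have h1 := ofReal_log_le_lintegral μ h4
    rw [← hI, hIJ, ENNReal.ofReal_le_ofReal_iff ENNReal.toReal_nonneg] at h1
    convert h1 using 2
    field_simp
    norm_num
  have hJ1 : 1 ≤ J := by
    refine le_trans ?_ hlog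
    rw [Real.le_log_iff_exp_le (by positivity), le_div_iff₀ hε]
    have := Real.exp_one_lt_d9
    nlinarith [Real.exp_pos 1]
  -- The `+ 1` makes `J < c * K` strict, as `abs_wordLaw_sub_one_le` requires.
  set K : ℕ := ⌊J / c⌋₊ + 1 with hK
  have hK1 : (K : ℝ) ≤ J / c + 1 := by
    rw [hK, Nat.cast_add, Nat.cast_one]
    exact add_le_add_left (Nat.floor_le (by positivity)) 1
  have hK2 : J < c * K := by
    have := Nat.lt_floor_add_one (J / c)
    rw [div_lt_iff₀ hc0] at this
    rw [hK, Nat.cast_add, Nat.cast_one]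
    linarith
  -- Half of `ε` goes to the words and half to the bad patterns; `4 / (ε/2)` is the upper limit
  -- `8/ε`.
  have hword : ∀ x : G, ∀ w : List (Option G), 2 * K ≤ w.count none →
      |wordLaw (fun x => (μ x).toReal) w x * Fintype.card G - 1| ≤ ε / 2 := by
    intro x w hw
    refine abs_wordLaw_sub_one_le μ hμ₀.le hμ hΦ (half_pos hε) (K := K) ?_ w hw x
    have : 4 / (ε / 2) = 8 / ε := by field_simp; norm_num
    rw [this, ← hI, hIJ, ← ENNReal.ofReal_natCast, ← ENNReal.ofReal_mul hc0.le,
      ENNReal.ofReal_lt_ofReal_iff (by positivity)]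
    exact hK2
  set n₀ : ℕ := ⌈60 * J / (c * (1 - α))⌉₊ with hn₀
  have hle1 : 1 ≤ J / (c * (1 - α)) := by
    rw [le_div_iff₀ (by positivity)]
    nlinarith
  have hle60 : 60 ≤ 60 * J / (c * (1 - α)) := by
    rw [mul_div_assoc]; linarith
  have hn₀60 : 60 ≤ n₀ := by
    have := hle60.trans (Nat.le_ceil _)
    exact_mod_cast this
  have hmix : ∀ m, n₀ ≤ m → uniformDist P S m ≤ ε := by
    intro m hm
    refine ciSup_le fun x => ?_
    have h1 := hS.abs_measureReal_sub_one_le hα hα' (n := m) (by omega) (half_pos hε).le x (hword x)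
    have h2 := card_mul_two_pow_mul_le hN hα' hα hε hc0 hc1 hlog hJ1 hK1
      ((Nat.le_ceil _).trans (Nat.cast_le.2 hm))
    linarith
  have h1 : uniformMixingTime P S ε ≤ (n₀ : ℕ∞) :=
    iInf₂_le n₀ ⟨by omega, hmix⟩
  calc (uniformMixingTime P S ε : ℝ≥0∞) ≤ ((n₀ : ℕ∞) : ℝ≥0∞) := ENat.toENNReal_le.2 h1
    _ = ENNReal.ofReal n₀ := by rw [ENat.toENNReal_coe, ENNReal.ofReal_natCast]
    _ ≤ ENNReal.ofReal (61 / c / (1 - α) * J) := by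
        refine ENNReal.ofReal_le_ofReal ((Nat.ceil_lt_add_one (by positivity)).le.trans ?_)
        have : 61 / c / (1 - α) * J = 60 * J / (c * (1 - α)) + J / (c * (1 - α)) := by
          field_simp
          norm_num
        rw [this]
        linarith
    _ = ENNReal.ofReal (61 / c / (1 - α)) * I := by
        rw [ENNReal.ofReal_mul (by positivity), hIJ]
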